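/- Let $(Y_i,X_i)$, $i\ge 1$, be i.i.d. pairs, where $Y_i=(Y_i^{(1)},\dots,Y_i^{(c)})$ has components in $\{0,1\}$ ($Y_i^{(j)}=1$ meaning that item $i$ belongs to class $j$) and $X_i\in\mathbb R^f$ is a feature vector; let $(Y,X)$ denote a generic pair. Of the first $n$ observations, only the first $r=r_n\le n$ are labeled, i.e. have $Y_i$ observed, and $r_n/n\to\gamma$ with $\gamma>0$. Fix a class $j$ and put $q_j=E\,Y^{(j)}$. Let $g:\mathbb R^f\times\mathbb R^p\to\mathbb R$, measurable in its first argument, and let $\theta_j\in\mathbb R^p$ be such that $$P(Y^{(j)}=1\mid X)=g(X,\theta_j)\quad\text{almost surely.}$$ Write $g'$ and $g''$ for the gradient and Hessian of $g$ in its second argument, and $w(t,\theta)=1/\{g(t,\theta)[1-g(t,\theta)]\}$. Assume the following regularity conditions, where "for almost every $t$" refers to the law of $X$ and $h$ is some function with $E|h(X)|<\infty$: 1. $\Theta\subset\mathbb R^p$ is compact and $\theta_j$ is an interior point of $\Theta$. For almost every $t$ and all $\theta\in\Theta$: $0<g(t,\theta)<1$, $g(t,\cdot)$ is $C^1$ near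 $\theta$, and $w(t,\theta)\|g'(t,\theta)\|\le h(t)$. 2. $\theta_j$ is identified by the estimating equation: if $\theta\in\Theta$ and $E[w(X,\theta)\{Y^{(j)}-g(X,\theta)\}g'(X,\theta)]=0$, then $\theta=\theta_j$. 3. There is a neighborhood $N$ of $\theta_j$ such that for almost every $t$ and all $\theta\in N$: $g(t,\cdot)$ is $C^2$ near $\theta$, $w(t,\theta)^2\|g'(t,\theta)\|^2\le h(t)$ and $w(t,\theta)\|g''(t,\theta)\|\le h(t)$. 4. The matrix $A_j=E[w(X,\theta_j)\,g'(X,\theta_j)\,g'(X,\theta_j)^T]$ is nonsingular. Put $B_j=E[g'(X,\theta_j)]$. For each $n$ let $\hat\theta_j=\hat\theta_{j,n}$ be a random vector in $\mathbb R^p$ such that, with probability tending to $1$ as $n\to\infty$, $\hat\theta_j\in\Theta$ and $$0=\sum_{i=1}^{r} w(X_i,\hat\theta_j)\{Y_i^{(j)}-g(X_i,\hat\theta_j)\}\,g'(X_i,\hat\theta_j),$$ and let $\hat q_j=\frac1n\sum_{i=1}^n g(X_i,\hat\theta_j)$. Then $n^{1/2}(\hat q_j-q_j)$ is asymptotically equivalent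 to $$n^{-1/2}\Big[\sum_{i=1}^n\{g(X_i,\theta_j)-q_j\}+\gamma^{-1}B_j^TA_j^{-1}\sum_{i=1}^{r}w(X_i,\theta_j)\{Y_i^{(j)}-g(X_i,\theta_j)\}\,g'(X_i,\theta_j)\Big],$$ that is, the difference of the two converges to $0$ in probability as $n\to\infty$. -/

import Mathlib

open MeasureTheory ProbabilityTheory Filter Topology

noncomputable section

namespace PriorEstimation

/-- Euclidean space of dimension `d`; features live in `Vec f`, parameters in `Vec p`. -/
abbrev Vec (d : ℕ) : Type := EuclideanSpace ℝ (Fin d)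

variable {f p : ℕ}

/-- The weight `w(t,θ) = 1 / (g(t,θ) (1 - g(t,θ)))`, the reciprocal of the conditional variance
of a Bernoulli variable with success probability `g(t,θ)`. -/
def weight (g : Vec f → Vec p → ℝ) (t : Vec f) (θ : Vec p) : ℝ :=
  1 / (g t θ * (1 - g t θ))

/-- `g'(t,θ)`: the vector of partial derivatives of `g` with respect to its second argument. -/
def grad (g : Vec f → Vec p → ℝ) (t : Vec f) (θ : Vec p) : Vec p :=
  gradient (fun η => g t η) θ

/-- `g''(t,θ)`: the Hessian of `g` with respect to its second argument, as a linear map. -/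
def hess (g : Vec f → Vec p → ℝ) (t : Vec f) (θ : Vec p) : Vec p →L[ℝ] Vec p :=
  fderiv ℝ (fun η => grad g t η) θ

/-- One summand `w(t,θ) (y - g(t,θ)) g'(t,θ)` of the estimating equation. -/
def score (g : Vec f → Vec p → ℝ) (t : Vec f) (y : ℝ) (θ : Vec p) : Vec p :=
  (weight g t θ * (y - g t θ)) • grad g t θ

/-- `A = E[w(X,θ) g'(X,θ) g'(X,θ)ᵀ]`, where `P` is the law of `X`. -/
def matA (g : Vec f → Vec p → ℝ) (θ : Vec p) (P : Measure (Vec f)) :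
    Matrix (Fin p) (Fin p) ℝ :=
  Matrix.of fun k l => ∫ t, weight g t θ * grad g t θ k * grad g t θ l ∂P

/-- `B = E[g'(X,θ)]`, where `P` is the law of `X`. -/
def vecB (g : Vec f → Vec p → ℝ) (θ : Vec p) (P : Measure (Vec f)) : Fin p → ℝ :=
  fun k => ∫ t, grad g t θ k ∂P

/-- The estimator `(1/n) ∑_{i<n} g(xᵢ, θ)` of the class prior probability. -/
def qHat (g : Vec f → Vec p → ℝ) (x : ℕ → Vec f) (n : ℕ) (θ : Vec p) : ℝ :=
  (1 / (n : ℝ)) * ∑ i ∈ Finset.range n, g (x i) θ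

/-- The asymptotic linear representation
`n^{-1/2} [∑_{i<n} (g(xᵢ,θ) - q) + γ⁻¹ Bᵀ A⁻¹ ∑_{i<r} w(xᵢ,θ) (yᵢ - g(xᵢ,θ)) g'(xᵢ,θ)]`. -/
def linearRep (g : Vec f → Vec p → ℝ) (θ : Vec p) (P : Measure (Vec f)) (q γ : ℝ)
    (x : ℕ → Vec f) (y : ℕ → ℝ) (r n : ℕ) : ℝ :=
  (1 / √(n : ℝ)) *
    ((∑ i ∈ Finset.range n, (g (x i) θ - q)) +
      γ⁻¹ * (vecB g θ P ⬝ᵥ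
        ((matA g θ P)⁻¹.mulVec fun k => ∑ i ∈ Finset.range r, score g (x i) (y i) θ k)))

end PriorEstimation

end

/-! The proof is the classical expansion of a Z-estimator, with uniform laws of large numbers
controlling all remainders. Regard a random function on a compact set `K` as a random element of the
Banach space `C(K, E)`; the strong law there is `uniform_law_of_large_numbers`. Applied to the score
on `Θ`, it makes every root an approximate zero of the mean score, which is continuous with only
zero `θ₀`; hence consistency (`eventuallyInProb_root_mem_ball`).

Applied to derivatives near `θ₀`, and combined with the mean value inequality, it gives
`empirical_mean_linearization`: on a fixed ball the empirical means of the score and of `g` are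
affine up to a relative error `κ`. The mean derivative of the score is `-A`, since the part carrying
the residual `y - g` averages to zero; that of `g` is `B`.

At a root the score expansion yields `u ≈ A⁻¹ F`, where `u = θhat - θ₀` and `F` is the mean score of
the labelled items at `θ₀`. Substituting in the expansion of `g` gives the correction `Bᵀ A⁻¹ F`,
and `n / r n → γ⁻¹` accounts for the different sample sizes. Since `√n F` is bounded in probability
by Chebyshev, the total error is `κ` times a constant (`abs_sub_le_of_linearization`), and `κ` is
arbitrary. -/

/-- The property `p n` holds with probability tending to one. -/
def EventuallyInProb {Ω : Type*} [MeasurableSpace Ω] (μ : Measure Ω) (p : ℕ → Ω → Prop) : Prop :=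
  Tendsto (fun n => μ {ω | ¬ p n ω}) atTop (𝓝 0)

namespace EventuallyInProb

variable {Ω : Type*} [MeasurableSpace Ω] {μ : Measure Ω} {p q : ℕ → Ω → Prop}

theorem mono (hp : EventuallyInProb μ p)
    (h : ∀ᶠ n in atTop, ∀ᵐ ω ∂μ, p n ω → q n ω) : EventuallyInProb μ q := by
  refine tendsto_of_tendsto_of_tendsto_of_le_of_le' tendsto_const_nhds hp
    (Eventually.of_forall fun n => zero_le) ?_
  filter_upwards [h] with n hn
  refine measure_mono_ae ?_
  filter_upwards [hn] with ω hω hq hp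
  exact hq (hω hp)

theorem and (hp : EventuallyInProb μ p) (hq : EventuallyInProb μ q) :
    EventuallyInProb μ (fun n ω => p n ω ∧ q n ω) := by
  have h := Tendsto.add hp hq
  rw [add_zero] at h
  refine tendsto_of_tendsto_of_tendsto_of_le_of_le tendsto_const_nhds h
    (fun n => zero_le) fun n => ?_
  refine (measure_mono ?_).trans (measure_union_le _ _)
  intro ω hω
  simp only [Set.mem_ofPred_eq, not_and_or] at hω
  exact hω

theorem comp (hp : EventuallyInProb μ p) {r : ℕ → ℕ} (hr : Tendsto r atTop atTop) :
    EventuallyInProb μ (fun n => p (r n)) :=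
  Tendsto.comp (g := fun n => μ {ω | ¬ p n ω}) hp hr

end EventuallyInProb

/-! ### Random continuous functions and the uniform law of large numbers -/

/-- A map into the continuous functions on a compact space is measurable if its evaluations are. -/
theorem measurable_continuousMap_of_eval {S K E : Type*} [MeasurableSpace S]
    [MetricSpace K] [CompactSpace K] [NormedAddCommGroup E] [SecondCountableTopology E]
    [MeasurableSpace E] [BorelSpace E] [MeasurableSpace C(K, E)] [BorelSpace C(K, E)]
    (F : S → C(K, E)) (hF : ∀ x, Measurable fun s => F s x) : Measurable F := by
  obtain ⟨D, hDc, hDd⟩ := TopologicalSpace.exists_countable_dense K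
  obtain ⟨C, hCc, hCd⟩ := TopologicalSpace.exists_countable_dense C(K, E)
  -- A closed sup-norm ball is cut out by countably many evaluations, those at the points of `D`.
  have hball : ∀ (c : C(K, E)) (q : ℝ), 0 ≤ q → MeasurableSet (F ⁻¹' Metric.closedBall c q) := by
    intro c q hq
    have : F ⁻¹' Metric.closedBall c q = ⋂ x ∈ D, {s | dist (F s x) (c x) ≤ q} := by
      ext s
      simp only [Set.mem_preimage, Metric.mem_closedBall, Set.mem_iInter, Set.mem_ofPred_eq]
      constructor
      · intro h x _
        exact (ContinuousMap.dist_apply_le_dist x).trans h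
      · intro h
        rw [ContinuousMap.dist_le hq]
        have hcl : IsClosed {x | dist (F s x) (c x) ≤ q} :=
          isClosed_le (by fun_prop) continuous_const
        intro x
        have : closure D ⊆ {x | dist (F s x) (c x) ≤ q} := hcl.closure_subset_iff.2 h
        exact this (hDd x)
    rw [this]
    exact MeasurableSet.biInter hDc fun x _ =>
      measurableSet_le ((hF x).dist measurable_const) measurable_const
  refine measurable_of_isOpen fun U hU => ?_
  -- By separability of `C(K, E)`, an open set is a countable union of such balls, with centres in
  -- `C` and radii `1 / (m + 1)`.
  have : F ⁻¹' U = ⋃ c ∈ C, ⋃ m ∈ {m : ℕ | Metric.closedBall c (1 / ((m : ℝ) + 1)) ⊆ U},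
      F ⁻¹' Metric.closedBall c (1 / ((m : ℝ) + 1)) := by
    ext s
    simp only [Set.mem_preimage, Set.mem_iUnion, Set.mem_ofPred_eq, exists_prop]
    constructor
    · intro hs
      obtain ⟨ε, hε, hsub⟩ := Metric.isOpen_iff.1 hU _ hs
      obtain ⟨m, hm⟩ := exists_nat_one_div_lt (half_pos hε)
      obtain ⟨c, hc, hcd⟩ := hCd.exists_dist_lt (F s)
        (show (0 : ℝ) < 1 / ((m : ℝ) + 1) by positivity)
      refine ⟨c, hc, m, fun f hf => hsub ?_, hcd.le⟩
      rw [Metric.mem_closedBall] at hf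
      rw [Metric.mem_ball]
      have := dist_triangle f c (F s)
      rw [dist_comm c] at this
      linarith
    · rintro ⟨c, _, m, hm, h⟩
      exact hm h
  rw [this]
  exact MeasurableSet.biUnion hCc fun c _ =>
    MeasurableSet.biUnion (Set.to_countable _) fun m _ => hball c _ (by positivity)

/-- A random function that is almost surely continuous on a compact set `K`, with measurable
values, has a measurable version with values in `C(K, E)`. -/
theorem exists_measurable_continuousMap_version {S T E : Type*} [MeasurableSpace S]
    {ν : Measure S} [MetricSpace T] [NormedAddCommGroup E]
    [SecondCountableTopology E] [MeasurableSpace E] [BorelSpace E] {K : Set T}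
    (hK : IsCompact K) [MeasurableSpace C(K, E)] [BorelSpace C(K, E)] {φ : S → T → E}
    (hmeas : ∀ θ ∈ K, AEMeasurable (fun s => φ s θ) ν)
    (hcont : ∀ᵐ s ∂ν, ContinuousOn (φ s) K) :
    ∃ F : S → C(K, E), Measurable F ∧ ∀ᵐ s ∂ν, ∀ θ : K, F s θ = φ s θ := by
  classical
  have : CompactSpace K := isCompact_iff_compactSpace.1 hK
  obtain ⟨D, hDc, hDd⟩ := TopologicalSpace.exists_countable_dense K
  have hae : ∀ᵐ s ∂ν, ContinuousOn (φ s) K ∧ ∀ θ ∈ D, φ s θ = (hmeas θ.1 θ.2).mk _ s := by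
    refine hcont.and ((ae_ball_iff hDc).2 fun θ _ => (hmeas θ.1 θ.2).ae_eq_mk)
  -- On the measurable conull set `G` the path is continuous and agrees on `D` with measurable
  -- versions. Setting `F` to zero off `G` makes evaluations on `D` measurable; the others are
  -- limits of these.
  obtain ⟨G, hGae, hGm, hG⟩ := hae.exists_measurable_mem
  have hGc : ∀ s ∈ G, Continuous fun θ : K => φ s θ := fun s hs =>
    continuousOn_iff_continuous_domRestrict.1 (hG s hs).1
  let F : S → C(K, E) := fun s => if hs : s ∈ G then ⟨fun θ : K => φ s θ, hGc s hs⟩ else 0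
  have hFG : ∀ s ∈ G, ∀ θ : K, F s θ = φ s θ := fun s hs θ => by simp [F, hs]
  refine ⟨F, measurable_continuousMap_of_eval F fun x => ?_, ?_⟩
  · have hD : ∀ θ ∈ D, Measurable fun s => F s θ := by
      intro θ hθ
      have : (fun s => F s θ) = G.indicator ((hmeas θ.1 θ.2).mk _) := by
        ext s
        by_cases hs : s ∈ G
        · rw [Set.indicator_of_mem hs, hFG s hs, (hG s hs).2 θ hθ]
        · simp [F, hs]
      rw [this]
      exact (hmeas θ.1 θ.2).measurable_mk.indicator hGm
    obtain ⟨u, huD, hu⟩ := mem_closure_iff_seq_limit.1 (hDd x)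
    refine measurable_of_tendsto_metrizable (fun n => hD (u n) (huD n)) ?_
    rw [tendsto_pi_nhds]
    exact fun s => ((F s).continuous.tendsto x).comp hu
  · filter_upwards [hGae] with s hs using hFG s hs

/-- Uniform law of large numbers over a compact set. -/
theorem uniform_law_of_large_numbers {Ω S T E : Type*} [MeasurableSpace Ω] {μ : Measure Ω}
    [IsProbabilityMeasure μ] [MeasurableSpace S] [MetricSpace T] [NormedAddCommGroup E]
    [NormedSpace ℝ E] [CompleteSpace E] [SecondCountableTopology E] [MeasurableSpace E]
    [BorelSpace E] {W : ℕ → Ω → S} (hW : ∀ i, Measurable (W i)) (hind : iIndepFun W μ)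
    (hid : ∀ i, IdentDistrib (W i) (W 0) μ μ) {K : Set T} (hK : IsCompact K) {φ : S → T → E}
    {H : S → ℝ} (hH : Integrable H (μ.map (W 0)))
    (hmeas : ∀ θ ∈ K, AEMeasurable (fun s => φ s θ) (μ.map (W 0)))
    (hcont : ∀ᵐ s ∂(μ.map (W 0)), ContinuousOn (φ s) K)
    (hbound : ∀ᵐ s ∂(μ.map (W 0)), ∀ θ ∈ K, ‖φ s θ‖ ≤ H s) :
    ContinuousOn (fun θ => ∫ s, φ s θ ∂(μ.map (W 0))) K ∧
      ∀ ε > 0, EventuallyInProb μ fun n ω => ∀ θ ∈ K,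
        ‖(n : ℝ)⁻¹ • ∑ i ∈ Finset.range n, φ (W i ω) θ - ∫ s, φ s θ ∂(μ.map (W 0))‖ ≤ ε := by
  have : CompactSpace K := isCompact_iff_compactSpace.1 hK
  let _ : MeasurableSpace C(K, E) := borel _
  have : BorelSpace C(K, E) := ⟨rfl⟩
  obtain ⟨F, hFm, hF⟩ := exists_measurable_continuousMap_version hK hmeas hcont
  have hFint : Integrable F (μ.map (W 0)) := by
    refine Integrable.mono' hH.norm hFm.aestronglyMeasurable ?_
    filter_upwards [hF, hbound] with s hs hb
    rw [ContinuousMap.norm_le _ (norm_nonneg _)]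
    intro θ
    rw [hs θ]
    exact (hb θ θ.2).trans (Real.le_norm_self _)
  -- The mean function is the Bochner integral of `F`, an element of `C(K, E)`, so its continuity is
  -- automatic.
  have hmean : ∀ θ : K, (∫ s, F s ∂(μ.map (W 0))) θ = ∫ s, φ s θ ∂(μ.map (W 0)) := by
    intro θ
    have h1 := (ContinuousMap.evalCLM ℝ θ : C(K, E) →L[ℝ] E).integral_comp_comm hFint
    rw [ContinuousMap.evalCLM_apply] at h1
    rw [← h1]
    refine integral_congr_ae ?_
    filter_upwards [hF] with s hs
    exact hs θ
  refine ⟨?_, fun ε hε => ?_⟩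
  · rw [continuousOn_iff_continuous_domRestrict]
    convert (∫ s, F s ∂(μ.map (W 0))).continuous using 1
    ext θ
    exact (hmean θ).symm
  have hae : ∀ᵐ ω ∂μ, ∀ i, ∀ θ : K, F (W i ω) θ = φ (W i ω) θ := by
    rw [ae_all_iff]
    intro i
    have := hF
    rw [← (hid i).map_eq] at this
    exact ae_of_ae_map (hW i).aemeasurable this
  have hlaw := strong_law_ae (μ := μ) (fun i => F ∘ W i)
    ((integrable_map_measure hFm.aestronglyMeasurable (hW 0).aemeasurable).1 hFint)
    (fun i k hik => (hind.indepFun hik).comp hFm hFm) (fun i => (hid i).comp hFm)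
  have hsum : ∀ n : ℕ, AEStronglyMeasurable
      (fun ω => (n : ℝ)⁻¹ • ∑ i ∈ Finset.range n, (F ∘ W i) ω) μ := fun n =>
    have h : Measurable fun ω => ∑ i ∈ Finset.range n, (F ∘ W i) ω :=
      Finset.measurable_fun_sum _ fun i _ => hFm.comp (hW i)
    h.aestronglyMeasurable.const_smul (n : ℝ)⁻¹
  have hconv := tendstoInMeasure_of_tendsto_ae hsum hlaw
  rw [tendstoInMeasure_iff_norm] at hconv
  have hev : EventuallyInProb μ fun n ω =>
      ‖(n : ℝ)⁻¹ • ∑ i ∈ Finset.range n, (F ∘ W i) ω - ∫ ω, (F ∘ W 0) ω ∂μ‖ < ε := by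
    simpa only [EventuallyInProb, not_lt] using hconv ε hε
  -- The sup-norm controls all `θ` at once. The event quantified over `θ` need not be measurable:
  -- `mono` compares outer measures.
  refine hev.mono (Eventually.of_forall fun n => ?_)
  filter_upwards [hae] with ω hω hlt θ hθ
  rw [← hmean ⟨θ, hθ⟩]
  have h2 := (ContinuousMap.norm_coe_le_norm
    ((n : ℝ)⁻¹ • ∑ i ∈ Finset.range n, (F ∘ W i) ω - ∫ ω, (F ∘ W 0) ω ∂μ) ⟨θ, hθ⟩).trans hlt.le
  have h3 : ∫ ω, (F ∘ W 0) ω ∂μ = ∫ s, F s ∂(μ.map (W 0)) :=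
    (integral_map (hW 0).aemeasurable hFm.aestronglyMeasurable).symm
  rw [h3] at h2
  simpa [ContinuousMap.sum_apply, hω] using h2

/-! ### Derivatives of random functions and uniform linearization -/

/-- A linear map out of a finite-dimensional space is measurable in a parameter if its values on
vectors are. -/
theorem aestronglyMeasurable_clm_of_apply {S V E : Type*} [MeasurableSpace S] {ν : Measure S}
    [NormedAddCommGroup V] [NormedSpace ℝ V] [FiniteDimensional ℝ V] [NormedAddCommGroup E]
    [NormedSpace ℝ E] {L : S → V →L[ℝ] E} (hL : ∀ v, AEStronglyMeasurable (fun s => L s v) ν) :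
    AEStronglyMeasurable L ν := by
  let b := Module.finBasis ℝ V
  have hrep : L = fun s => ∑ i, (ContinuousLinearMap.smulRightL ℝ V E
      (LinearMap.toContinuousLinearMap (b.coord i))) (L s (b i)) := by
    ext s v
    have h := congrArg (L s) (b.sum_repr v)
    simp only [map_sum, map_smul] at h
    simp [h]
  rw [hrep]
  exact Finset.aestronglyMeasurable_fun_sum _ fun i _ =>
    (ContinuousLinearMap.continuous _).comp_aestronglyMeasurable (hL (b i))

/-- The derivative at a point of a random function is measurable. -/
theorem aestronglyMeasurable_fderiv_of_nhds {S V E : Type*} [MeasurableSpace S] {ν : Measure S}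
    [NormedAddCommGroup V] [NormedSpace ℝ V] [FiniteDimensional ℝ V] [NormedAddCommGroup E]
    [NormedSpace ℝ E] {φ : S → V → E} {θ : V}
    (hmeas : ∀ᶠ η in 𝓝 θ, AEStronglyMeasurable (fun s => φ s η) ν)
    (hdiff : ∀ᵐ s ∂ν, DifferentiableAt ℝ (φ s) θ) :
    AEStronglyMeasurable (fun s => fderiv ℝ (φ s) θ) ν := by
  refine aestronglyMeasurable_clm_of_apply fun v => ?_
  have hlim : Tendsto (fun c : ℝ => θ + c⁻¹ • v) atTop (𝓝 θ) := by
    simpa using (tendsto_const_nhds (x := θ)).add ((tendsto_inv_atTop_zero (𝕜 := ℝ)).smul_const v)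
  obtain ⟨C, hC⟩ := eventually_atTop.1 (hlim.eventually hmeas)
  -- The derivative along `v` is a limit of difference quotients with step `1 / (C + n)`; the shift
  -- by `C` keeps every evaluation point where measurability is assumed.
  have hc : Tendsto (fun n : ℕ => C + (n : ℝ)) atTop atTop :=
    tendsto_atTop_add_const_left _ _ tendsto_natCast_atTop_atTop
  refine aestronglyMeasurable_of_tendsto_ae atTop
    (f := fun (n : ℕ) s => (C + (n : ℝ)) • (φ s (θ + (C + (n : ℝ))⁻¹ • v) - φ s θ)) (fun n => ?_) ?_
  · exact ((hC _ (by simp)).sub hmeas.self_of_nhds).const_smul _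
  · filter_upwards [hdiff] with s hs
    exact (hs.hasFDerivAt.lim_real v).comp hc

/-- Uniform linearization of an empirical mean near a point. -/
theorem empirical_mean_linearization {Ω S V E : Type*} [MeasurableSpace Ω] {μ : Measure Ω}
    [IsProbabilityMeasure μ] [MeasurableSpace S]
    [NormedAddCommGroup V] [NormedSpace ℝ V] [FiniteDimensional ℝ V]
    [NormedAddCommGroup E] [NormedSpace ℝ E] [FiniteDimensional ℝ E]
    {W : ℕ → Ω → S} (hW : ∀ i, Measurable (W i)) (hind : iIndepFun W μ)
    (hid : ∀ i, IdentDistrib (W i) (W 0) μ μ) {θ₀ : V} {R : ℝ} (hR : 0 < R) {φ : S → V → E}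
    {H : S → ℝ} (hH : Integrable H (μ.map (W 0)))
    (hmeas : ∀ θ ∈ Metric.closedBall θ₀ R, AEStronglyMeasurable (fun s => φ s θ) (μ.map (W 0)))
    (hC1 : ∀ᵐ s ∂(μ.map (W 0)), ∀ θ ∈ Metric.closedBall θ₀ R, ContDiffAt ℝ 1 (φ s) θ)
    (hbound : ∀ᵐ s ∂(μ.map (W 0)), ∀ θ ∈ Metric.closedBall θ₀ R, ‖fderiv ℝ (φ s) θ‖ ≤ H s)
    {κ : ℝ} (hκ : 0 < κ) :
    ∃ δ > 0, EventuallyInProb μ fun n ω => ∀ θ ∈ Metric.ball θ₀ δ,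
      ‖(n : ℝ)⁻¹ • ∑ i ∈ Finset.range n, φ (W i ω) θ
        - (n : ℝ)⁻¹ • ∑ i ∈ Finset.range n, φ (W i ω) θ₀
        - (∫ s, fderiv ℝ (φ s) θ₀ ∂(μ.map (W 0))) (θ - θ₀)‖ ≤ κ * ‖θ - θ₀‖ := by
  set ν := μ.map (W 0) with hν
  have _ : ProperSpace V := FiniteDimensional.proper_real V
  have _ : ProperSpace (V →L[ℝ] E) := FiniteDimensional.proper_real _
  -- Halving the radius leaves a neighbourhood of each point on which values are measurable, as
  -- measurability of the derivative requires.
  have hsub : Metric.closedBall θ₀ (R / 2) ⊆ Metric.closedBall θ₀ R :=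
    Metric.closedBall_subset_closedBall (by linarith)
  have hK : IsCompact (Metric.closedBall θ₀ (R / 2)) := isCompact_closedBall _ _
  have hθ₀ : θ₀ ∈ Metric.closedBall θ₀ (R / 2) := Metric.mem_closedBall_self (by linarith)
  have hmeas' : ∀ θ ∈ Metric.closedBall θ₀ (R / 2),
      AEMeasurable (fun s => fderiv ℝ (φ s) θ) ν := by
    intro θ hθ
    refine (aestronglyMeasurable_fderiv_of_nhds ?_ ?_).aemeasurable
    · have : Metric.ball θ₀ R ∈ 𝓝 θ := Metric.isOpen_ball.mem_nhds
        (Metric.closedBall_subset_ball (by linarith) hθ)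
      filter_upwards [this] with η hη using hmeas η (Metric.ball_subset_closedBall hη)
    · filter_upwards [hC1] with s hs
      exact (hs θ (hsub hθ)).differentiableAt one_ne_zero
  obtain ⟨hcont, hlaw⟩ := uniform_law_of_large_numbers hW hind hid hK hH hmeas'
    (by
      filter_upwards [hC1] with s hs
      intro θ hθ
      exact ((hs θ (hsub hθ)).fderiv_right (m := 0) (by norm_num)).continuousAt.continuousWithinAt)
    (by filter_upwards [hbound] with s hs θ hθ using hs θ (hsub hθ))
  rw [Metric.continuousOn_iff] at hcont
  obtain ⟨δ, hδ, hcδ⟩ := hcont θ₀ hθ₀ (κ / 2) (half_pos hκ)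
  refine ⟨min δ (R / 2), lt_min hδ (by linarith), (hlaw (κ / 2) (half_pos hκ)).mono
    (Eventually.of_forall fun n => ?_)⟩
  have hae : ∀ᵐ ω ∂μ, ∀ i, ∀ θ ∈ Metric.closedBall θ₀ R, ContDiffAt ℝ 1 (φ (W i ω)) θ := by
    rw [ae_all_iff]
    intro i
    rw [hν, ← (hid i).map_eq] at hC1
    exact ae_of_ae_map (hW i).aemeasurable hC1
  filter_upwards [hae] with ω hω hn θ hθ
  have hball : ∀ η ∈ Metric.ball θ₀ (min δ (R / 2)), η ∈ Metric.closedBall θ₀ (R / 2) :=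
    fun η hη => Metric.ball_subset_closedBall (Metric.ball_subset_ball (min_le_right _ _) hη)
  -- Mean value inequality: the empirical derivative is within `κ / 2` of its mean by the uniform
  -- law, and the mean derivative within `κ / 2` of its value at `θ₀` by continuity.
  refine (convex_ball θ₀ (min δ (R / 2))).norm_image_sub_le_of_norm_hasFDerivWithin_le' (𝕜 := ℝ)
    (f := fun θ => (n : ℝ)⁻¹ • ∑ i ∈ Finset.range n, φ (W i ω) θ)
    (f' := fun θ => (n : ℝ)⁻¹ • ∑ i ∈ Finset.range n, fderiv ℝ (φ (W i ω)) θ) (fun η hη => ?_)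
    (fun η hη => ?_) (Metric.mem_ball_self (lt_min hδ (by linarith))) hθ
  · refine HasFDerivAt.hasFDerivWithinAt ?_
    refine HasFDerivAt.const_smul (HasFDerivAt.fun_sum fun i _ => ?_) _
    exact ((hω i η (hsub (hball η hη))).differentiableAt one_ne_zero).hasFDerivAt
  · have h1 := hn η (hball η hη)
    have h2 := (hcδ η (hball η hη) (lt_of_lt_of_le hη (min_le_left _ _))).le
    rw [dist_eq_norm] at h2
    calc _ ≤ _ := norm_sub_le_norm_sub_add_norm_sub _ (∫ s, fderiv ℝ (φ s) η ∂ν) _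
      _ ≤ κ / 2 + κ / 2 := add_le_add h1 h2
      _ = κ := by ring

/-! ### Calculus of the score -/

namespace PriorEstimation

section Calculus

variable {f p : ℕ} {g : Vec f → Vec p → ℝ} {t : Vec f} {θ : Vec p}

theorem fderiv_eq_inner_grad (v : Vec p) :
    fderiv ℝ (fun η => g t η) θ v = inner ℝ (grad g t θ) v := by
  simp [grad, gradient]

theorem norm_fderiv_eq_norm_grad : ‖fderiv ℝ (fun η => g t η) θ‖ = ‖grad g t θ‖ := by
  simp [grad, gradient]

theorem continuousAt_grad (h : ContDiffAt ℝ 1 (fun η => g t η) θ) :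
    ContinuousAt (fun η => grad g t η) θ :=
  (InnerProductSpace.toDual ℝ (Vec p)).symm.continuous.continuousAt.comp
    (h.fderiv_right (m := 0) (by norm_num)).continuousAt

theorem contDiffAt_grad (h : ContDiffAt ℝ 2 (fun η => g t η) θ) :
    ContDiffAt ℝ 1 (fun η => grad g t η) θ :=
  (InnerProductSpace.toDual ℝ (Vec p)).symm.toContinuousLinearEquiv.contDiff.contDiffAt.comp θ
    (h.fderiv_right (m := 1) (by norm_num))

/-- A Bernoulli variance is at most one. Hence envelopes for `w ‖g'‖` also bound `‖g'‖`, and `w ≤ w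
^ 2`. -/
theorem one_le_weight (h : 0 < g t θ ∧ g t θ < 1) : 1 ≤ weight g t θ := by
  rw [weight, le_div_iff₀ (mul_pos h.1 (by linarith [h.2]))]
  nlinarith [h.1, h.2]

theorem norm_score_le {y : ℝ} (hy : y = 0 ∨ y = 1) (h : 0 < g t θ ∧ g t θ < 1) :
    ‖score g t y θ‖ ≤ weight g t θ * ‖grad g t θ‖ := by
  have hw := one_le_weight h
  have h1 : |y - g t θ| ≤ 1 := by
    rw [abs_le]
    rcases hy with rfl | rfl <;> constructor <;> linarith [h.1, h.2]
  rw [score, norm_smul, Real.norm_eq_abs, abs_mul, abs_of_nonneg (by linarith)]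
  have : weight g t θ * |y - g t θ| ≤ weight g t θ * 1 := by gcongr
  rw [mul_one] at this
  gcongr

theorem continuousAt_score {y : ℝ} (h : 0 < g t θ ∧ g t θ < 1)
    (hC : ContDiffAt ℝ 1 (fun η => g t η) θ) : ContinuousAt (fun η => score g t y η) θ := by
  have hne : g t θ * (1 - g t θ) ≠ 0 := (mul_pos h.1 (by linarith [h.2])).ne'
  have hc := hC.continuousAt
  have hg := continuousAt_grad hC
  unfold score weight
  fun_prop (disch := exact hne)

theorem contDiffAt_score {y : ℝ} (h : 0 < g t θ ∧ g t θ < 1)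
    (hC : ContDiffAt ℝ 2 (fun η => g t η) θ) : ContDiffAt ℝ 1 (fun η => score g t y η) θ := by
  have hne : g t θ * (1 - g t θ) ≠ 0 := (mul_pos h.1 (by linarith [h.2])).ne'
  have hc : ContDiffAt ℝ 1 (fun η => g t η) θ := hC.of_le (by norm_num)
  have hg := contDiffAt_grad hC
  unfold score weight
  fun_prop (disch := exact hne)

/-- The derivative of `w(t,θ) g'(t,θ)` in `θ`, the factor of the residual in the derivative of the
score. -/
noncomputable def curvature (g : Vec f → Vec p → ℝ) (t : Vec f) (θ : Vec p) : Vec p →L[ℝ] Vec p :=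
  weight g t θ • hess g t θ - ((1 - 2 * g t θ) * weight g t θ ^ 2) •
    (fderiv ℝ (fun η => g t η) θ).smulRight (grad g t θ)

/-- Product rule with `w' = -(1 - 2 g) w ^ 2 g'`. The grouping isolates the residual: its factor
depends on `t` only and drops out of the mean at the true parameter, while the other term averages
to the information matrix. -/
theorem hasFDerivAt_score {y : ℝ} (h : 0 < g t θ ∧ g t θ < 1)
    (hC : ContDiffAt ℝ 2 (fun η => g t η) θ) :
    HasFDerivAt (fun η => score g t y η) ((y - g t θ) • curvature g t θ -
      weight g t θ • (fderiv ℝ (fun η => g t η) θ).smulRight (grad g t θ)) θ := by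
  have hne : g t θ * (1 - g t θ) ≠ 0 := (mul_pos h.1 (by linarith [h.2])).ne'
  have h0 : g t θ ≠ 0 := h.1.ne'
  have h1 : 1 - g t θ ≠ 0 := by linarith [h.2]
  have hg : HasFDerivAt (fun η => g t η) (fderiv ℝ (fun η => g t η) θ) θ :=
    (hC.differentiableAt two_ne_zero).hasFDerivAt
  have hgr : HasFDerivAt (fun η => grad g t η) (hess g t θ) θ :=
    ((contDiffAt_grad hC).differentiableAt one_ne_zero).hasFDerivAt
  have hw : HasFDerivAt (fun η => weight g t η) _ θ :=
    (hasDerivAt_inv hne).comp_hasFDerivAt θ (hg.mul (hg.const_sub 1)) |>.congr_of_eventuallyEq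
      (Eventually.of_forall fun η => by simp [weight])
  refine ((hw.mul (hg.const_sub y)).smul hgr).congr_fderiv ?_
  ext v k
  simp [curvature, weight]
  field_simp
  ring

theorem norm_curvature_le {b : ℝ} (h : 0 < g t θ ∧ g t θ < 1)
    (h1 : (weight g t θ * ‖grad g t θ‖) ^ 2 ≤ b) (h2 : weight g t θ * ‖hess g t θ‖ ≤ b) :
    ‖curvature g t θ‖ ≤ 2 * b := by
  have hw := one_le_weight h
  have h3 : |1 - 2 * g t θ| ≤ 1 := by rw [abs_le]; constructor <;> linarith [h.1, h.2]
  refine (norm_sub_le _ _).trans ?_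
  rw [norm_smul, norm_smul, ContinuousLinearMap.norm_smulRight_apply, norm_fderiv_eq_norm_grad,
    Real.norm_eq_abs, Real.norm_eq_abs, abs_mul, abs_of_nonneg (by linarith : 0 ≤ weight g t θ),
    abs_of_nonneg (sq_nonneg (weight g t θ))]
  have : |1 - 2 * g t θ| * weight g t θ ^ 2 * (‖grad g t θ‖ * ‖grad g t θ‖) ≤
      1 * weight g t θ ^ 2 * (‖grad g t θ‖ * ‖grad g t θ‖) := by gcongr
  nlinarith

theorem norm_weight_smul_smulRight_le {b : ℝ} (h : 0 < g t θ ∧ g t θ < 1)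
    (h1 : (weight g t θ * ‖grad g t θ‖) ^ 2 ≤ b) :
    ‖weight g t θ • (fderiv ℝ (fun η => g t η) θ).smulRight (grad g t θ)‖ ≤ b := by
  have hw := one_le_weight h
  rw [norm_smul, ContinuousLinearMap.norm_smulRight_apply, norm_fderiv_eq_norm_grad,
    Real.norm_eq_abs, abs_of_nonneg (by linarith : 0 ≤ weight g t θ)]
  refine le_trans ?_ h1
  have : weight g t θ * (‖grad g t θ‖ * ‖grad g t θ‖) ≤
      weight g t θ ^ 2 * (‖grad g t θ‖ * ‖grad g t θ‖) := by
    gcongr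
    nlinarith
  nlinarith

/-- The residual is at most one in absolute value, so the constant is two from the curvature plus
one from the information term. -/
theorem norm_fderiv_score_le {y b : ℝ} (hy : y = 0 ∨ y = 1) (h : 0 < g t θ ∧ g t θ < 1)
    (hC : ContDiffAt ℝ 2 (fun η => g t η) θ)
    (h1 : (weight g t θ * ‖grad g t θ‖) ^ 2 ≤ b) (h2 : weight g t θ * ‖hess g t θ‖ ≤ b) :
    ‖fderiv ℝ (fun η => score g t y η) θ‖ ≤ 3 * b := by
  rw [(hasFDerivAt_score h hC).fderiv]
  have h3 : |y - g t θ| ≤ 1 := by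
    rw [abs_le]
    rcases hy with rfl | rfl <;> constructor <;> linarith [h.1, h.2]
  have h4 := norm_curvature_le h h1 h2
  refine (norm_sub_le _ _).trans ?_
  rw [norm_smul, Real.norm_eq_abs]
  have h5 : |y - g t θ| * ‖curvature g t θ‖ ≤ 1 * ‖curvature g t θ‖ := by gcongr
  linarith [norm_weight_smul_smulRight_le h h1]

theorem norm_grad_le_weight_mul (h : 0 < g t θ ∧ g t θ < 1) :
    ‖grad g t θ‖ ≤ weight g t θ * ‖grad g t θ‖ :=
  le_mul_of_one_le_left (norm_nonneg _) (one_le_weight h)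

end Calculus

/-! ### Measurability of the model and the score -/

section Measurability

variable {f p : ℕ} {g : Vec f → Vec p → ℝ} {P : Measure (Vec f)} {θ : Vec p}

theorem aestronglyMeasurable_fderiv_model (hg : ∀ θ, Measurable fun t => g t θ)
    (hd : ∀ᵐ t ∂P, DifferentiableAt ℝ (fun η => g t η) θ) :
    AEStronglyMeasurable (fun t => fderiv ℝ (fun η => g t η) θ) P :=
  aestronglyMeasurable_fderiv_of_nhds
    (Eventually.of_forall fun η => (hg η).aestronglyMeasurable) hd

theorem aestronglyMeasurable_grad (hg : ∀ θ, Measurable fun t => g t θ)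
    (hd : ∀ᵐ t ∂P, DifferentiableAt ℝ (fun η => g t η) θ) :
    AEStronglyMeasurable (fun t => grad g t θ) P :=
  (InnerProductSpace.toDual ℝ (Vec p)).symm.continuous.comp_aestronglyMeasurable
    (aestronglyMeasurable_fderiv_model hg hd)

theorem measurable_weight (hg : ∀ θ, Measurable fun t => g t θ) (θ : Vec p) :
    Measurable fun t => weight g t θ := by
  have := hg θ
  unfold weight
  fun_prop

theorem aestronglyMeasurable_score {ν : Measure (ℝ × Vec f)}
    (hg : ∀ θ, Measurable fun t => g t θ)
    (hd : ∀ᵐ t ∂(ν.map Prod.snd), DifferentiableAt ℝ (fun η => g t η) θ) :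
    AEStronglyMeasurable (fun s : ℝ × Vec f => score g s.2 s.1 θ) ν := by
  have h1 := (aestronglyMeasurable_grad hg hd).comp_measurable measurable_snd
  have h2 : Measurable fun s : ℝ × Vec f => weight g s.2 θ * (s.1 - g s.2 θ) :=
    ((measurable_weight hg θ).comp measurable_snd).mul
      (measurable_fst.sub ((hg θ).comp measurable_snd))
  exact h2.aestronglyMeasurable.smul h1

end Measurability

/-! ### Moments of the score and its derivative at the true parameter -/

/-- Local regularity of a binary regression model `g` for the law `ν` of `(y, x)`, on the closed
ball of radius `R` about the true parameter `θ₀`, with integrable envelope `h`. -/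
structure LocalRegularity {f p : ℕ} (g : Vec f → Vec p → ℝ) (θ₀ : Vec p) (R : ℝ)
    (ν : Measure (ℝ × Vec f)) (h : Vec f → ℝ) : Prop where
  radius_pos : 0 < R
  measurable : ∀ θ, Measurable fun t => g t θ
  binary : ∀ᵐ s ∂ν, s.1 = 0 ∨ s.1 = 1
  range : ∀ᵐ t ∂(ν.map Prod.snd), ∀ θ ∈ Metric.closedBall θ₀ R, 0 < g t θ ∧ g t θ < 1
  smooth : ∀ᵐ t ∂(ν.map Prod.snd), ∀ θ ∈ Metric.closedBall θ₀ R,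
    ContDiffAt ℝ 2 (fun η => g t η) θ
  integrable : Integrable h (ν.map Prod.snd)
  env : ∀ᵐ t ∂(ν.map Prod.snd), ∀ θ ∈ Metric.closedBall θ₀ R,
    weight g t θ * ‖grad g t θ‖ ≤ h t
  env_sq : ∀ᵐ t ∂(ν.map Prod.snd), ∀ θ ∈ Metric.closedBall θ₀ R,
    (weight g t θ * ‖grad g t θ‖) ^ 2 ≤ h t
  env_hess : ∀ᵐ t ∂(ν.map Prod.snd), ∀ θ ∈ Metric.closedBall θ₀ R,
    weight g t θ * ‖hess g t θ‖ ≤ h t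
  -- The only form in which the conditional model enters the local analysis.
  residual_orthogonal : ∀ m : Vec f → ℝ, Integrable m (ν.map Prod.snd) →
    ∫ s, (s.1 - g s.2 θ₀) * m s.2 ∂ν = 0

theorem _root_.MeasureTheory.ae_of_ae_map_snd {α β : Type*} [MeasurableSpace α]
    [MeasurableSpace β] {ν : Measure (α × β)} {q : β → Prop} (h : ∀ᵐ t ∂(ν.map Prod.snd), q t) :
    ∀ᵐ s ∂ν, q s.2 :=
  ae_of_ae_map measurable_snd.aemeasurable h

namespace LocalRegularity

variable {f p : ℕ} {g : Vec f → Vec p → ℝ} {θ₀ : Vec p} {R : ℝ} {ν : Measure (ℝ × Vec f)}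
  {h : Vec f → ℝ}

theorem center_mem (M : LocalRegularity g θ₀ R ν h) : θ₀ ∈ Metric.closedBall θ₀ R :=
  Metric.mem_closedBall_self M.radius_pos.le

theorem integrable_envelope (M : LocalRegularity g θ₀ R ν h) :
    Integrable (fun s => h s.2) ν :=
  (integrable_map_measure M.integrable.1 measurable_snd.aemeasurable).1 M.integrable

theorem ae_differentiableAt (M : LocalRegularity g θ₀ R ν h) {θ : Vec p}
    (hθ : θ ∈ Metric.closedBall θ₀ R) :
    ∀ᵐ t ∂(ν.map Prod.snd), DifferentiableAt ℝ (fun η => g t η) θ := by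
  filter_upwards [M.smooth] with t ht using (ht θ hθ).differentiableAt two_ne_zero

theorem aestronglyMeasurable_score (M : LocalRegularity g θ₀ R ν h) {θ : Vec p}
    (hθ : θ ∈ Metric.closedBall θ₀ R) :
    AEStronglyMeasurable (fun s : ℝ × Vec f => score g s.2 s.1 θ) ν :=
  PriorEstimation.aestronglyMeasurable_score M.measurable (M.ae_differentiableAt hθ)

theorem ae_norm_fderiv_score_le (M : LocalRegularity g θ₀ R ν h) :
    ∀ᵐ s ∂ν, ∀ θ ∈ Metric.closedBall θ₀ R,
      ‖fderiv ℝ (fun η => score g s.2 s.1 η) θ‖ ≤ 3 * h s.2 := by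
  filter_upwards [M.binary, ae_of_ae_map_snd M.range, ae_of_ae_map_snd M.smooth,
    ae_of_ae_map_snd M.env_sq, ae_of_ae_map_snd M.env_hess] with s h1 h2 h3 h4 h5 θ hθ
  exact norm_fderiv_score_le h1 (h2 θ hθ) (h3 θ hθ) (h4 θ hθ) (h5 θ hθ)

theorem ae_contDiffAt_score (M : LocalRegularity g θ₀ R ν h) :
    ∀ᵐ s ∂ν, ∀ θ ∈ Metric.closedBall θ₀ R, ContDiffAt ℝ 1 (fun η => score g s.2 s.1 η) θ := by
  filter_upwards [ae_of_ae_map_snd M.range, ae_of_ae_map_snd M.smooth] with s h2 h3 θ hθ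
  exact contDiffAt_score (h2 θ hθ) (h3 θ hθ)

theorem integrable_fderiv_score (M : LocalRegularity g θ₀ R ν h) :
    Integrable (fun s => fderiv ℝ (fun η => score g s.2 s.1 η) θ₀) ν := by
  refine (M.integrable_envelope.const_mul 3).mono' ?_ ?_
  · refine aestronglyMeasurable_fderiv_of_nhds ?_ ?_
    · filter_upwards [Metric.closedBall_mem_nhds θ₀ M.radius_pos] with η hη
        using M.aestronglyMeasurable_score hη
    · filter_upwards [M.ae_contDiffAt_score] with s hs
        using (hs θ₀ M.center_mem).differentiableAt one_ne_zero
  · filter_upwards [M.ae_norm_fderiv_score_le] with s hs using hs θ₀ M.center_mem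

theorem integrable_fderiv (M : LocalRegularity g θ₀ R ν h) :
    Integrable (fun t => fderiv ℝ (fun η => g t η) θ₀) (ν.map Prod.snd) := by
  refine M.integrable.mono'
    (aestronglyMeasurable_fderiv_model M.measurable (M.ae_differentiableAt M.center_mem)) ?_
  filter_upwards [M.range, M.env] with t h1 h2
  rw [norm_fderiv_eq_norm_grad]
  exact (norm_grad_le_weight_mul (h1 θ₀ M.center_mem)).trans (h2 θ₀ M.center_mem)

theorem aestronglyMeasurable_grad (M : LocalRegularity g θ₀ R ν h) :
    AEStronglyMeasurable (fun t => grad g t θ₀) (ν.map Prod.snd) :=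
  PriorEstimation.aestronglyMeasurable_grad M.measurable (M.ae_differentiableAt M.center_mem)

/-- This makes the entries of the curvature admissible test functions in `residual_orthogonal`. -/
theorem integrable_curvature (M : LocalRegularity g θ₀ R ν h) :
    Integrable (fun t => curvature g t θ₀) (ν.map Prod.snd) := by
  refine (M.integrable.const_mul 2).mono' ?_ ?_
  · have hh : AEStronglyMeasurable (fun t => hess g t θ₀) (ν.map Prod.snd) := by
      refine aestronglyMeasurable_fderiv_of_nhds (φ := fun t η => grad g t η) ?_ ?_
      · filter_upwards [Metric.closedBall_mem_nhds θ₀ M.radius_pos] with η hη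
          using PriorEstimation.aestronglyMeasurable_grad M.measurable (M.ae_differentiableAt hη)
      · filter_upwards [M.smooth] with t ht
          using (contDiffAt_grad (ht θ₀ M.center_mem)).differentiableAt one_ne_zero
    have hw := measurable_weight M.measurable θ₀
    have hg := M.measurable θ₀
    have hs : AEStronglyMeasurable (fun t => (fderiv ℝ (fun η => g t η) θ₀).smulRight
        (grad g t θ₀)) (ν.map Prod.snd) :=
      (ContinuousLinearMap.smulRightL ℝ (Vec p) (Vec p)).aestronglyMeasurable_comp₂
        M.integrable_fderiv.1 M.aestronglyMeasurable_grad
    have hc : Measurable fun t => (1 - 2 * g t θ₀) * weight g t θ₀ ^ 2 := by fun_prop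
    exact (hw.aestronglyMeasurable.smul hh).sub (hc.aestronglyMeasurable.smul hs)
  · filter_upwards [M.range, M.env_sq, M.env_hess] with t h1 h2 h3
    exact norm_curvature_le (h1 θ₀ M.center_mem) (h2 θ₀ M.center_mem) (h3 θ₀ M.center_mem)

theorem integrable_information (M : LocalRegularity g θ₀ R ν h) (k l : Fin p) :
    Integrable (fun t => weight g t θ₀ * grad g t θ₀ k * grad g t θ₀ l) (ν.map Prod.snd) := by
  have hk : ∀ k : Fin p, AEStronglyMeasurable (fun t => grad g t θ₀ k) (ν.map Prod.snd) :=
    fun k => (EuclideanSpace.proj (𝕜 := ℝ) k).continuous.comp_aestronglyMeasurable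
      M.aestronglyMeasurable_grad
  refine M.integrable.mono'
    (((measurable_weight M.measurable θ₀).aestronglyMeasurable.mul (hk k)).mul (hk l)) ?_
  filter_upwards [M.range, M.env_sq] with t h1 h2
  refine le_trans ?_ (norm_weight_smul_smulRight_le (h1 θ₀ M.center_mem) (h2 θ₀ M.center_mem))
  rw [norm_smul, ContinuousLinearMap.norm_smulRight_apply, norm_fderiv_eq_norm_grad, norm_mul,
    norm_mul, mul_assoc]
  gcongr
  · exact PiLp.norm_apply_le _ k
  · exact PiLp.norm_apply_le _ l

/-- The derivative of the mean score at the true parameter is minus the information matrix. -/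
theorem integral_fderiv_score_apply (M : LocalRegularity g θ₀ R ν h) (v : Vec p) (k : Fin p) :
    (∫ s, fderiv ℝ (fun η => score g s.2 s.1 η) θ₀ ∂ν) v k =
      -((matA g θ₀ (ν.map Prod.snd)).mulVec v) k := by
  have hm : Integrable (fun t => (curvature g t θ₀ v) k) (ν.map Prod.snd) :=
    (EuclideanSpace.proj (𝕜 := ℝ) k).integrable_comp
      ((ContinuousLinearMap.apply ℝ (Vec p) v).integrable_comp M.integrable_curvature)
  have hI : Integrable (fun t => ∑ l, weight g t θ₀ * grad g t θ₀ k * grad g t θ₀ l * v l)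
      (ν.map Prod.snd) :=
    integrable_finsetSum _ fun l _ => (M.integrable_information k l).mul_const _
  have hI' : Integrable (fun s : ℝ × Vec f =>
      ∑ l, weight g s.2 θ₀ * grad g s.2 θ₀ k * grad g s.2 θ₀ l * v l) ν :=
    (integrable_map_measure hI.1 measurable_snd.aemeasurable).1 hI
  have hF : Integrable (fun s => (fderiv ℝ (fun η => score g s.2 s.1 η) θ₀ v) k) ν :=
    (EuclideanSpace.proj (𝕜 := ℝ) k).integrable_comp
      ((ContinuousLinearMap.apply ℝ (Vec p) v).integrable_comp M.integrable_fderiv_score)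
  have hae : ∀ᵐ s ∂ν, (fderiv ℝ (fun η => score g s.2 s.1 η) θ₀ v) k =
      (s.1 - g s.2 θ₀) * (curvature g s.2 θ₀ v) k -
        ∑ l, weight g s.2 θ₀ * grad g s.2 θ₀ k * grad g s.2 θ₀ l * v l := by
    filter_upwards [ae_of_ae_map_snd M.range, ae_of_ae_map_snd M.smooth] with s h2 h3
    rw [(hasFDerivAt_score (h2 θ₀ M.center_mem) (h3 θ₀ M.center_mem)).fderiv]
    simp only [sub_apply, smul_apply,
      ContinuousLinearMap.smulRight_apply, PiLp.sub_apply, PiLp.smul_apply, smul_eq_mul,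
      fderiv_eq_inner_grad, PiLp.inner_apply, RCLike.inner_apply, conj_trivial, Finset.sum_mul,
      Finset.mul_sum]
    congr 1
    exact Finset.sum_congr rfl fun l _ => by ring
  -- Splitting the integral needs this product to be integrable, which `residual_orthogonal` does
  -- not assert; it is the sum of a derivative entry and an information term.
  have hprod : Integrable (fun s => (s.1 - g s.2 θ₀) * (curvature g s.2 θ₀ v) k) ν := by
    refine (hF.add hI').congr ?_
    filter_upwards [hae] with s hs
    simp [hs]
  have e1 : (∫ s, fderiv ℝ (fun η => score g s.2 s.1 η) θ₀ ∂ν) v k =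
      ∫ s, (fderiv ℝ (fun η => score g s.2 s.1 η) θ₀ v) k ∂ν := by
    rw [ContinuousLinearMap.integral_apply M.integrable_fderiv_score]
    exact ((EuclideanSpace.proj (𝕜 := ℝ) k).integral_comp_comm
      ((ContinuousLinearMap.apply ℝ (Vec p) v).integrable_comp M.integrable_fderiv_score)).symm
  rw [e1, integral_congr_ae hae, integral_sub hprod hI', M.residual_orthogonal _ hm, zero_sub,
    ← integral_map (φ := Prod.snd) measurable_snd.aemeasurable hI.1,
    integral_finsetSum _ fun l _ => (M.integrable_information k l).mul_const _]
  simp [matA, Matrix.mulVec, dotProduct, integral_mul_const]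

theorem integral_fderiv_apply (M : LocalRegularity g θ₀ R ν h) (v : Vec p) :
    (∫ s, fderiv ℝ (fun η => g s.2 η) θ₀ ∂ν) v = vecB g θ₀ (ν.map Prod.snd) ⬝ᵥ v := by
  rw [← integral_map (φ := Prod.snd) (f := fun t => fderiv ℝ (fun η => g t η) θ₀)
    measurable_snd.aemeasurable M.integrable_fderiv.1,
    ContinuousLinearMap.integral_apply M.integrable_fderiv]
  have hg : Integrable (fun t => grad g t θ₀) (ν.map Prod.snd) :=
    (InnerProductSpace.toDual ℝ (Vec p)).symm.toContinuousLinearEquiv.toContinuousLinearMap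
      |>.integrable_comp M.integrable_fderiv
  simp only [fderiv_eq_inner_grad, PiLp.inner_apply, RCLike.inner_apply, conj_trivial]
  have hgl : ∀ l : Fin p, Integrable (fun t => grad g t θ₀ l) (ν.map Prod.snd) :=
    fun l => (EuclideanSpace.proj (𝕜 := ℝ) l).integrable_comp hg
  rw [integral_finsetSum _ fun l _ => (hgl l).const_mul _]
  simp only [vecB, dotProduct, integral_const_mul, mul_comm]

/-- The score at the true parameter is square integrable. -/
theorem memLp_score [IsFiniteMeasure ν] (M : LocalRegularity g θ₀ R ν h) :
    MemLp (fun s : ℝ × Vec f => score g s.2 s.1 θ₀) 2 ν := by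
  rw [memLp_two_iff_integrable_sq_norm (M.aestronglyMeasurable_score M.center_mem)]
  refine M.integrable_envelope.mono'
    ((M.aestronglyMeasurable_score M.center_mem).norm.pow 2) ?_
  filter_upwards [M.binary, ae_of_ae_map_snd M.range, ae_of_ae_map_snd M.env_sq] with s h1 h2 h3
  rw [Real.norm_eq_abs, abs_of_nonneg (sq_nonneg _)]
  refine le_trans ?_ (h3 θ₀ M.center_mem)
  gcongr
  exact norm_score_le h1 (h2 θ₀ M.center_mem)

/-- The score at the true parameter is centered. -/
theorem integral_score_apply (M : LocalRegularity g θ₀ R ν h) (k : Fin p) :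
    ∫ s, score g s.2 s.1 θ₀ k ∂ν = 0 := by
  have hm : Integrable (fun t => weight g t θ₀ * grad g t θ₀ k) (ν.map Prod.snd) := by
    refine M.integrable.mono' ((measurable_weight M.measurable θ₀).aestronglyMeasurable.mul
      ((EuclideanSpace.proj (𝕜 := ℝ) k).continuous.comp_aestronglyMeasurable
        M.aestronglyMeasurable_grad)) ?_
    filter_upwards [M.range, M.env] with t h1 h2
    refine le_trans ?_ (h2 θ₀ M.center_mem)
    have hw := one_le_weight (h1 θ₀ M.center_mem)
    rw [norm_mul, Real.norm_eq_abs, abs_of_nonneg (by linarith)]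
    gcongr
    exact PiLp.norm_apply_le _ k
  rw [← M.residual_orthogonal _ hm]
  refine integral_congr_ae (Eventually.of_forall fun s => ?_)
  simp only [score, PiLp.smul_apply, smul_eq_mul]
  ring

end LocalRegularity

/-! ### Boundedness in probability and the deterministic expansion -/

/-- Normalized partial sums of centered square integrable i.i.d. vectors are bounded in
probability. -/
theorem exists_forall_measure_lt_norm_le {Ω S : Type*} [MeasurableSpace Ω] {μ : Measure Ω}
    [IsProbabilityMeasure μ] [MeasurableSpace S] {p : ℕ}
    {W : ℕ → Ω → S} (hW : ∀ i, Measurable (W i)) (hind : iIndepFun W μ)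
    (hid : ∀ i, IdentDistrib (W i) (W 0) μ μ) {Z : S → Vec p}
    (hZ : MemLp Z 2 (μ.map (W 0))) (hmean : ∀ k, ∫ s, Z s k ∂(μ.map (W 0)) = 0)
    {r : ℕ → ℕ} (hr : ∀ n, r n ≤ n) {η : ENNReal} (hη : 0 < η) :
    ∃ C : ℝ, 0 < C ∧ ∀ n : ℕ, 0 < n →
      μ {ω | ¬ ‖(√(n : ℝ))⁻¹ • ∑ i ∈ Finset.range (r n), Z (W i ω)‖ ≤ C} ≤ η := by
  have hZk : ∀ k, MemLp (fun s => Z s k) 2 (μ.map (W 0)) := fun k =>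
    (EuclideanSpace.proj (𝕜 := ℝ) k).comp_memLp' hZ
  have hmap : ∀ i, μ.map (W i) = μ.map (W 0) := fun i => (hid i).map_eq
  have hX : ∀ k i, MemLp (fun ω => Z (W i ω) k) 2 μ := fun k i =>
    (memLp_map_measure_iff (g := fun s => Z s k) (by rw [hmap i]; exact (hZk k).1) (hW i).aemeasurable).1
      (by rw [hmap i]; exact hZk k)
  have hXid : ∀ k i, IdentDistrib (fun ω => Z (W i ω) k) (fun ω => Z (W 0 ω) k) μ μ := fun k i =>
    (hid i).comp_of_aemeasurable (u := fun s => Z s k)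
      (by rw [hmap i]; exact (hZk k).1.aemeasurable)
  have hXmean : ∀ k i, ∫ ω, Z (W i ω) k ∂μ = 0 := by
    intro k i
    rw [(hXid k i).integral_eq, ← hmean k]
    exact (integral_map (hW 0).aemeasurable (hZk k).1).symm
  set V : Fin p → ℝ := fun k => variance (fun ω => Z (W 0 ω) k) μ with hV
  have hV0 : ∀ k, 0 ≤ V k := fun k => variance_nonneg _ _
  have hlim : Tendsto (fun c : ℝ => ENNReal.ofReal ((∑ k, V k) / c ^ 2)) atTop (𝓝 0) := by
    have : Tendsto (fun c : ℝ => (∑ k, V k) / c ^ 2) atTop (𝓝 0) :=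
      tendsto_const_nhds.div_atTop (tendsto_pow_atTop two_ne_zero)
    simpa using ENNReal.tendsto_ofReal this
  obtain ⟨c, hcη, hc⟩ := ((hlim.eventually (ge_mem_nhds hη)).and (eventually_gt_atTop 0)).exists
  -- If each coordinate of the sum is at most `c √n`, its norm is at most `p c √n`; adding `1` keeps
  -- the constant positive when `p = 0`. Chebyshev bounds the failure of coordinate `k` by `V k / c
  -- ^ 2`, using `r n ≤ n`.
  refine ⟨p * c + 1, by positivity, fun n hn => le_trans ?_ hcη⟩
  have hn' : 0 < √(n : ℝ) := Real.sqrt_pos.2 (by exact_mod_cast hn)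
  have hcheb : ∀ k, μ {ω | c * √(n : ℝ) ≤ |∑ i ∈ Finset.range (r n), Z (W i ω) k|} ≤
      ENNReal.ofReal (V k / c ^ 2) := by
    intro k
    have hsum : MemLp (∑ i ∈ Finset.range (r n), fun ω => Z (W i ω) k) 2 μ :=
      memLp_finsetSum' _ fun i _ => hX k i
    have hmean' : ∫ ω, (∑ i ∈ Finset.range (r n), fun ω => Z (W i ω) k) ω ∂μ = 0 := by
      simp only [Finset.sum_apply]
      rw [integral_finsetSum _ fun i _ => (hX k i).integrable one_le_two]
      simp [hXmean]
    have hvar : variance (∑ i ∈ Finset.range (r n), fun ω => Z (W i ω) k) μ = r n * V k := by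
      rw [IndepFun.variance_sum (fun i _ => hX k i)]
      · simp [fun i => (hXid k i).variance_eq, hV]
      · intro i _ l _ hil
        exact (hind.indepFun hil).comp₀ (hW i).aemeasurable (hW l).aemeasurable
          (φ := fun s => Z s k) (ψ := fun s => Z s k)
          (by rw [hmap i]; exact (hZk k).1.aemeasurable)
          (by rw [hmap l]; exact (hZk k).1.aemeasurable)
    have h := meas_ge_le_variance_div_sq hsum (mul_pos hc hn')
    rw [hmean', hvar] at h
    simp only [Finset.sum_apply, sub_zero] at h
    refine h.trans (ENNReal.ofReal_le_ofReal ?_)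
    rw [mul_pow, Real.sq_sqrt (by positivity), mul_comm (c ^ 2), mul_comm (r n : ℝ),
      mul_comm (n : ℝ)]
    have hrn : (r n : ℝ) ≤ n := by exact_mod_cast hr n
    have hnp : (0 : ℝ) < n := by exact_mod_cast hn
    rw [div_le_div_iff₀ (by positivity) (by positivity)]
    have := hV0 k
    calc V k * r n * c ^ 2 ≤ V k * n * c ^ 2 := by gcongr
      _ = V k * (c ^ 2 * n) := by ring
  calc μ {ω | ¬ ‖(√(n : ℝ))⁻¹ • ∑ i ∈ Finset.range (r n), Z (W i ω)‖ ≤ p * c + 1}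
      ≤ μ (⋃ k, {ω | c * √(n : ℝ) ≤ |∑ i ∈ Finset.range (r n), Z (W i ω) k|}) := by
        refine measure_mono fun ω hω => ?_
        by_contra hcon
        simp only [Set.mem_iUnion, Set.mem_ofPred_eq, not_exists, not_le] at hcon
        refine hω ?_
        set z := ∑ i ∈ Finset.range (r n), Z (W i ω) with hz
        have hzk : ∀ k, |z k| ≤ c * √(n : ℝ) := fun k => by
          have := (hcon k).le
          simpa [hz] using this
        have hznorm : ‖z‖ ≤ ∑ k, |z k| := by
          have h1 := (EuclideanSpace.basisFun (Fin p) ℝ).sum_repr z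
          calc ‖z‖ = ‖∑ k, z k • EuclideanSpace.basisFun (Fin p) ℝ k‖ := by
                conv_lhs => rw [← h1]
                simp
            _ ≤ ∑ k, ‖z k • EuclideanSpace.basisFun (Fin p) ℝ k‖ := norm_sum_le _ _
            _ = ∑ k, |z k| := by simp [norm_smul]
        have hzn : ‖z‖ ≤ p * (c * √(n : ℝ)) := by
          refine hznorm.trans ((Finset.sum_le_sum fun k _ => hzk k).trans ?_)
          simp
        rw [norm_smul, norm_inv, Real.norm_eq_abs, abs_of_pos hn', inv_mul_le_iff₀ hn']
        nlinarith
    _ ≤ ∑ k, ENNReal.ofReal (V k / c ^ 2) :=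
        (measure_iUnion_fintype_le _ _).trans (Finset.sum_le_sum fun k _ => hcheb k)
    _ = ENNReal.ofReal ((∑ k, V k) / c ^ 2) := by
        rw [Finset.sum_div, ENNReal.ofReal_sum_of_nonneg]
        intro k _
        have := hV0 k
        positivity

/-- If two smooth statistics are linearized at a point with relative error `κ` and the first one
vanishes, the second one is approximately a linear function of the value of the first one at the
base point. -/
theorem abs_sub_le_of_linearization {V : Type*} [NormedAddCommGroup V] [NormedSpace ℝ V]
    {L Ainv : V →L[ℝ] V} (hinv : ∀ v, Ainv (L v) = -v) (b : V →L[ℝ] ℝ) {u F T : V}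
    {Δ κ ρ γ' C m : ℝ} (hm : 0 ≤ m) (hκ : ‖Ainv‖ * κ ≤ 1 / 2) (hκ0 : 0 ≤ κ) (hρ0 : 0 ≤ ρ)
    (hF : ‖F + L u‖ ≤ κ * ‖u‖) (hΔ : |Δ - b u| ≤ κ * ‖u‖) (hT : m • F = ρ • T) (hTC : ‖T‖ ≤ C)
    (hρ : |ρ - γ'| ≤ κ) :
    |m * Δ - γ' * b (Ainv T)| ≤
      κ * (C * (2 * ‖Ainv‖ * ρ + ‖b‖ * (2 * ‖Ainv‖ ^ 2 * ρ + ‖Ainv‖))) := by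
  set a := ‖Ainv‖ with ha
  have ha0 : 0 ≤ a := norm_nonneg _
  have hC : 0 ≤ C := (norm_nonneg T).trans hTC
  have h1 : ‖u - Ainv F‖ ≤ a * (κ * ‖u‖) := by
    have : u - Ainv F = -Ainv (F + L u) := by rw [map_add, hinv]; abel
    rw [this, norm_neg]
    exact (Ainv.le_opNorm _).trans (by gcongr)
  -- Since `a κ ≤ 1 / 2`, the linearization error is absorbed in the left side. This turns mere
  -- consistency into the root-n rate.
  have h2 : ‖u‖ ≤ 2 * (a * ‖F‖) := by
    have h3 : ‖u‖ ≤ ‖u - Ainv F‖ + ‖Ainv F‖ := by simpa using norm_add_le (u - Ainv F) (Ainv F)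
    have h4 := Ainv.le_opNorm F
    nlinarith [norm_nonneg u]
  have hmF : m * ‖F‖ ≤ ρ * C := by
    have := congrArg norm hT
    rw [norm_smul, norm_smul, Real.norm_eq_abs, Real.norm_eq_abs, abs_of_nonneg hm,
      abs_of_nonneg hρ0] at this
    rw [this]
    gcongr
  have hmu : m * ‖u‖ ≤ 2 * a * ρ * C := by
    calc m * ‖u‖ ≤ m * (2 * (a * ‖F‖)) := by gcongr
      _ = 2 * a * (m * ‖F‖) := by ring
      _ ≤ 2 * a * (ρ * C) := by gcongr
      _ = _ := by ring
  -- Three errors: linearizing the second statistic, replacing `u` by `Ainv F`, and replacing `ρ` by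
  -- its limit.
  have hdec : m * Δ - γ' * b (Ainv T) =
      m * (Δ - b u) + m * b (u - Ainv F) + (ρ - γ') * b (Ainv T) := by
    have : m * b (Ainv F) = ρ * b (Ainv T) := by
      have := congrArg (fun v => b (Ainv v)) hT
      simpa using this
    rw [map_sub]
    linear_combination this
  rw [hdec]
  have e1 : |m * (Δ - b u)| ≤ κ * (2 * a * ρ * C) := by
    rw [abs_mul, abs_of_nonneg hm]
    calc m * |Δ - b u| ≤ m * (κ * ‖u‖) := by gcongr
      _ = κ * (m * ‖u‖) := by ring
      _ ≤ _ := by gcongr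
  have e2 : |m * b (u - Ainv F)| ≤ κ * (‖b‖ * a * (2 * a * ρ * C)) := by
    rw [abs_mul, abs_of_nonneg hm]
    have := b.le_opNorm (u - Ainv F)
    rw [Real.norm_eq_abs] at this
    calc m * |b (u - Ainv F)| ≤ m * (‖b‖ * (a * (κ * ‖u‖))) := by
          gcongr
          exact this.trans (by gcongr)
      _ = κ * (‖b‖ * a * (m * ‖u‖)) := by ring
      _ ≤ _ := by gcongr
  have e3 : |(ρ - γ') * b (Ainv T)| ≤ κ * (‖b‖ * (a * C)) := by
    rw [abs_mul]
    have h5 := b.le_opNorm (Ainv T)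
    rw [Real.norm_eq_abs] at h5
    have h6 := Ainv.le_opNorm T
    have : |b (Ainv T)| ≤ ‖b‖ * (a * C) := h5.trans (by gcongr; exact h6.trans (by gcongr))
    gcongr
  calc _ ≤ |m * (Δ - b u)| + |m * b (u - Ainv F)| + |(ρ - γ') * b (Ainv T)| := abs_add_three _ _ _
    _ ≤ _ := add_le_add_three e1 e2 e3
    _ = _ := by ring

/-! ### Consistency -/

/-- A continuous function on a compact set with a unique zero is bounded away from zero outside
each neighbourhood of that zero. -/
theorem exists_pos_forall_norm_le_imp_mem_ball {V E : Type*} [MetricSpace V]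
    [NormedAddCommGroup E] {K : Set V} (hK : IsCompact K) {S : V → E} (hS : ContinuousOn S K)
    {θ₀ : V} (huniq : ∀ θ ∈ K, S θ = 0 → θ = θ₀) {δ : ℝ} (hδ : 0 < δ) :
    ∃ ε > 0, ∀ θ ∈ K, ‖S θ‖ ≤ ε → θ ∈ Metric.ball θ₀ δ := by
  have hc : IsCompact (K \ Metric.ball θ₀ δ) := hK.diff Metric.isOpen_ball
  rcases (K \ Metric.ball θ₀ δ).eq_empty_or_nonempty with he | hne
  · exact ⟨1, one_pos, fun θ hθ _ => Set.sdiff_eq_empty.1 he hθ⟩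
  · obtain ⟨x, hx, hmin⟩ := hc.exists_isMinOn hne (hS.norm.mono Set.sdiff_subset)
    have hpos : 0 < ‖S x‖ := by
      rw [norm_pos_iff]
      intro h0
      exact hx.2 (huniq x hx.1 h0 ▸ Metric.mem_ball_self hδ)
    refine ⟨‖S x‖ / 2, half_pos hpos, fun θ hθ hle => ?_⟩
    by_contra hcon
    have : ‖S x‖ ≤ ‖S θ‖ := hmin ⟨hθ, hcon⟩
    linarith

/-- Consistency of roots of the estimating equation that lie in a compact parameter set. -/
theorem eventuallyInProb_root_mem_ball {Ω : Type*} [MeasurableSpace Ω] {μ : Measure Ω}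
    [IsProbabilityMeasure μ] {f p : ℕ} {g : Vec f → Vec p → ℝ} {θ₀ : Vec p} {h : Vec f → ℝ}
    {W : ℕ → Ω → ℝ × Vec f} (hW : ∀ i, Measurable (W i)) (hind : iIndepFun W μ)
    (hid : ∀ i, IdentDistrib (W i) (W 0) μ μ) {Θ : Set (Vec p)} (hΘ : IsCompact Θ)
    (hbin : ∀ᵐ s ∂(μ.map (W 0)), s.1 = 0 ∨ s.1 = 1)
    (hgmeas : ∀ θ, Measurable fun t => g t θ)
    (hg01 : ∀ᵐ t ∂((μ.map (W 0)).map Prod.snd), ∀ θ ∈ Θ, 0 < g t θ ∧ g t θ < 1)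
    (hgC1 : ∀ᵐ t ∂((μ.map (W 0)).map Prod.snd), ∀ θ ∈ Θ, ContDiffAt ℝ 1 (fun η => g t η) θ)
    (hint : Integrable h ((μ.map (W 0)).map Prod.snd))
    (henv : ∀ᵐ t ∂((μ.map (W 0)).map Prod.snd), ∀ θ ∈ Θ, weight g t θ * ‖grad g t θ‖ ≤ h t)
    (hunique : ∀ θ ∈ Θ, ∫ s, score g s.2 s.1 θ ∂(μ.map (W 0)) = 0 → θ = θ₀)
    {r : ℕ → ℕ} (hr : Tendsto r atTop atTop) {θhat : ℕ → Ω → Vec p}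
    (hroot : EventuallyInProb μ fun n ω => θhat n ω ∈ Θ ∧
      ∑ i ∈ Finset.range (r n), score g (W i ω).2 (W i ω).1 (θhat n ω) = 0)
    {δ : ℝ} (hδ : 0 < δ) : EventuallyInProb μ fun n ω => θhat n ω ∈ Metric.ball θ₀ δ := by
  have hmeas : ∀ θ ∈ Θ,
      AEMeasurable (fun s : ℝ × Vec f => score g s.2 s.1 θ) (μ.map (W 0)) := by
    intro θ hθ
    refine (aestronglyMeasurable_score hgmeas ?_).aemeasurable
    filter_upwards [hgC1] with t ht using (ht θ hθ).differentiableAt one_ne_zero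
  obtain ⟨hcont, hlaw⟩ := uniform_law_of_large_numbers hW hind hid hΘ
    (φ := fun s θ => score g s.2 s.1 θ) (H := fun s => h s.2)
    ((integrable_map_measure hint.1 measurable_snd.aemeasurable).1 hint) hmeas
    (by
      filter_upwards [ae_of_ae_map_snd hg01, ae_of_ae_map_snd hgC1] with s h1 h2 θ hθ
      exact (continuousAt_score (h1 θ hθ) (h2 θ hθ)).continuousWithinAt)
    (by
      filter_upwards [hbin, ae_of_ae_map_snd hg01, ae_of_ae_map_snd henv] with s h1 h2 h3 θ hθ
      exact (norm_score_le h1 (h2 θ hθ)).trans (h3 θ hθ))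
  obtain ⟨ε, hε, hball⟩ := exists_pos_forall_norm_le_imp_mem_ball hΘ hcont hunique hδ
  -- Uniformity allows evaluation at the random root: the empirical score vanishes there, so the
  -- mean score has norm at most `ε`.
  refine (hroot.and ((hlaw ε hε).comp hr)).mono
    (Eventually.of_forall fun n => Eventually.of_forall fun ω => ?_)
  rintro ⟨⟨hmem, hzero⟩, hn⟩
  have := hn _ hmem
  rw [hzero, smul_zero, zero_sub, norm_neg] at this
  exact hball _ hmem this

/-! ### Asymptotic linearity -/

/-- Asymptotic linearity of the estimated class prior for a consistent root of the estimating
equation. -/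
theorem tendstoInMeasure_qHat_sub_linearRep {Ω : Type*} [MeasurableSpace Ω] {μ : Measure Ω}
    [IsProbabilityMeasure μ] {f p : ℕ} {g : Vec f → Vec p → ℝ} {θ₀ : Vec p} {R : ℝ}
    {h : Vec f → ℝ} {W : ℕ → Ω → ℝ × Vec f} (hW : ∀ i, Measurable (W i)) (hind : iIndepFun W μ)
    (hid : ∀ i, IdentDistrib (W i) (W 0) μ μ)
    (M : LocalRegularity g θ₀ R (μ.map (W 0)) h)
    (hA : IsUnit (matA g θ₀ ((μ.map (W 0)).map Prod.snd)).det)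
    {r : ℕ → ℕ} (hr : ∀ n, r n ≤ n) {γ : ℝ} (hγ : 0 < γ)
    (hrγ : Tendsto (fun n => (r n : ℝ) / (n : ℝ)) atTop (𝓝 γ)) (hr' : Tendsto r atTop atTop)
    {θhat : ℕ → Ω → Vec p}
    (hroot : EventuallyInProb μ fun n ω =>
      ∑ i ∈ Finset.range (r n), score g (W i ω).2 (W i ω).1 (θhat n ω) = 0)
    (hcons : ∀ δ > 0, EventuallyInProb μ fun n ω => θhat n ω ∈ Metric.ball θ₀ δ) (q : ℝ) :
    TendstoInMeasure μ (fun (n : ℕ) ω =>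
      √(n : ℝ) * (qHat g (fun i => (W i ω).2) n (θhat n ω) - q) -
        linearRep g θ₀ ((μ.map (W 0)).map Prod.snd) q γ (fun i => (W i ω).2)
          (fun i => (W i ω).1) (r n) n) atTop (fun _ => (0 : ℝ)) := by
  have _ : IsProbabilityMeasure (μ.map (W 0)) :=
    Measure.isProbabilityMeasure_map (hW 0).aemeasurable
  set ν := μ.map (W 0) with hν
  set A := matA g θ₀ (ν.map Prod.snd) with hAdef
  set L : Vec p →L[ℝ] Vec p := ∫ s, fderiv ℝ (fun η => score g s.2 s.1 η) θ₀ ∂ν with hL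
  set b : Vec p →L[ℝ] ℝ := ∫ s, fderiv ℝ (fun η => g s.2 η) θ₀ ∂ν with hb
  set Ainv : Vec p →L[ℝ] Vec p :=
    LinearMap.toContinuousLinearMap (Matrix.toEuclideanLin A⁻¹) with hAinv
  have hAinv_apply : ∀ v, Ainv v = WithLp.toLp 2 (A⁻¹.mulVec v.ofLp) := fun v => rfl
  have hLv : ∀ v, L v = WithLp.toLp 2 (-(A.mulVec v.ofLp)) := by
    intro v
    ext k
    exact M.integral_fderiv_score_apply v k
  have hinv : ∀ v, Ainv (L v) = -v := by
    intro v
    rw [hLv, hAinv_apply]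
    simp only [Matrix.mulVec_neg, Matrix.mulVec_mulVec, Matrix.nonsing_inv_mul A hA,
      Matrix.one_mulVec]
    rfl
  rw [tendstoInMeasure_iff_norm]
  intro ε hε
  rw [ENNReal.tendsto_atTop_zero]
  intro η hη
  obtain ⟨C, hC0, hC⟩ := exists_forall_measure_lt_norm_le hW hind hid M.memLp_score
    M.integral_score_apply hr (ENNReal.half_pos hη.ne')
  -- The constant of `abs_sub_le_of_linearization` with `n / r n` replaced by the eventual bound
  -- `γ⁻¹ + 1`, valid because `κ ≤ 1`. It involves neither `n` nor `κ`, so `κ` can be chosen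
  -- afterwards, and the radii after `κ`.
  set D := C * (2 * ‖Ainv‖ * (γ⁻¹ + 1) + ‖b‖ * (2 * ‖Ainv‖ ^ 2 * (γ⁻¹ + 1) + ‖Ainv‖)) with hD
  have hD0 : 0 ≤ D := by positivity
  obtain ⟨κ, hκ0, hκ1, hκ2, hκ3⟩ : ∃ κ : ℝ, 0 < κ ∧ κ ≤ 1 ∧ ‖Ainv‖ * κ ≤ 1 / 2 ∧ κ * D < ε := by
    have h1 : Tendsto (fun κ : ℝ => ‖Ainv‖ * κ) (𝓝[>] 0) (𝓝 0) := by
      have : Continuous fun κ : ℝ => ‖Ainv‖ * κ := by fun_prop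
      simpa using (this.tendsto 0).mono_left nhdsWithin_le_nhds
    have h2 : Tendsto (fun κ : ℝ => κ * D) (𝓝[>] 0) (𝓝 0) := by
      have : Continuous fun κ : ℝ => κ * D := by fun_prop
      simpa using (this.tendsto 0).mono_left nhdsWithin_le_nhds
    have h3 : Tendsto (fun κ : ℝ => κ) (𝓝[>] 0) (𝓝 0) := nhdsWithin_le_nhds
    exact (eventually_mem_nhdsWithin.and ((h3.eventually (ge_mem_nhds one_pos)).and
      ((h1.eventually (ge_mem_nhds one_half_pos)).and (h2.eventually (gt_mem_nhds hε))))).exists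
  obtain ⟨δ₁, hδ₁, hlin₁⟩ := empirical_mean_linearization hW hind hid M.radius_pos
    (φ := fun s θ => score g s.2 s.1 θ) (M.integrable_envelope.const_mul 3)
    (fun θ hθ => M.aestronglyMeasurable_score hθ) M.ae_contDiffAt_score
    M.ae_norm_fderiv_score_le hκ0
  obtain ⟨δ₂, hδ₂, hlin₂⟩ := empirical_mean_linearization hW hind hid M.radius_pos
    (φ := fun s θ => g s.2 θ) M.integrable_envelope
    (fun θ _ => ((M.measurable θ).comp measurable_snd).aestronglyMeasurable)
    (by
      filter_upwards [ae_of_ae_map_snd M.smooth] with s hs θ hθ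
      exact (hs θ hθ).of_le (by norm_num))
    (by
      filter_upwards [ae_of_ae_map_snd M.range, ae_of_ae_map_snd M.env] with s h1 h2 θ hθ
      rw [norm_fderiv_eq_norm_grad]
      exact (norm_grad_le_weight_mul (h1 θ hθ)).trans (h2 θ hθ))
    hκ0
  -- The score is averaged over the `r n` labelled items, hence the composition with `hr'`; `g` is
  -- averaged over all `n`.
  have hgood := (hroot.and (hcons _ (lt_min hδ₁ hδ₂))).and ((hlin₁.comp hr').and hlin₂)
  have hgood' := hgood.eventually (ge_mem_nhds (ENNReal.half_pos hη.ne'))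
  have hρ : Tendsto (fun n : ℕ => (n : ℝ) / (r n : ℝ)) atTop (𝓝 γ⁻¹) := by
    simpa using hrγ.inv₀ hγ.ne'
  have hρ' := Metric.tendsto_nhds.1 hρ κ hκ0
  have hev := hgood'.and (hρ'.and ((eventually_gt_atTop 0).and (hr'.eventually_gt_atTop 0)))
  obtain ⟨n₀, hn₀⟩ := eventually_atTop.1 hev
  refine ⟨n₀, fun n hn => ?_⟩
  obtain ⟨hG, hρn, hnpos, hrpos⟩ := hn₀ n hn
  have hnR : (0 : ℝ) < n := by exact_mod_cast hnpos
  have hrR : (0 : ℝ) < r n := by exact_mod_cast hrpos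
  have hsq : 0 < √(n : ℝ) := Real.sqrt_pos.2 hnR
  have hss : √(n : ℝ) * √(n : ℝ) = n := Real.mul_self_sqrt hnR.le
  rw [Real.dist_eq] at hρn
  refine le_trans (measure_mono ?_) ((measure_union_le _ _).trans
    ((add_le_add hG (hC n hnpos)).trans (ENNReal.add_halves η).le))
  intro ω hω
  by_contra hcon
  simp only [Set.mem_union, Set.mem_ofPred_eq, not_or, not_not] at hcon
  obtain ⟨⟨⟨hz, hball⟩, hl₁, hl₂⟩, hT⟩ := hcon
  have h1 := hl₁ _ (Metric.ball_subset_ball (min_le_left _ _) hball)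
  have h2 := hl₂ _ (Metric.ball_subset_ball (min_le_right _ _) hball)
  rw [hz, smul_zero, zero_sub, ← neg_add', norm_neg] at h1
  rw [Real.norm_eq_abs] at h2
  set Sr := ∑ i ∈ Finset.range (r n), score g (W i ω).2 (W i ω).1 θ₀ with hSr
  have hscale : √(n : ℝ) • ((r n : ℝ)⁻¹ • Sr) = ((n : ℝ) / r n) • ((√(n : ℝ))⁻¹ • Sr) := by
    rw [smul_smul, smul_smul]
    congr 1
    field_simp
    linarith
  have hρ0 : (0 : ℝ) ≤ (n : ℝ) / r n := by positivity
  have key := abs_sub_le_of_linearization hinv b hsq.le hκ2 hκ0.le hρ0 h1 h2 hscale hT hρn.le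
  have hle : κ * (C * (2 * ‖Ainv‖ * ((n : ℝ) / r n) +
      ‖b‖ * (2 * ‖Ainv‖ ^ 2 * ((n : ℝ) / r n) + ‖Ainv‖))) ≤ κ * D := by
    have : (n : ℝ) / r n ≤ γ⁻¹ + 1 := by linarith [(abs_lt.1 hρn).2]
    rw [hD]
    gcongr
  have hlt := (key.trans hle).trans_lt hκ3
  refine absurd hω ?_
  simp only [Set.mem_ofPred_eq, not_le, sub_zero, Real.norm_eq_abs]
  convert hlt using 2
  have hbA : b (Ainv ((√(n : ℝ))⁻¹ • Sr)) = (√(n : ℝ))⁻¹ * (vecB g θ₀ (ν.map Prod.snd) ⬝ᵥ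
      A⁻¹.mulVec fun k => ∑ i ∈ Finset.range (r n), score g (W i ω).2 (W i ω).1 θ₀ k) := by
    have hSk : Sr.ofLp = fun k =>
        ∑ i ∈ Finset.range (r n), score g (W i ω).2 (W i ω).1 θ₀ k := by
      ext k
      simp [hSr]
    rw [map_smul, map_smul, smul_eq_mul, hb, M.integral_fderiv_apply, hAinv_apply, hSk]
  rw [hbA]
  -- The centring `q` contributes `√n q` to both expressions and cancels, so its value is
  -- immaterial.
  simp only [qHat, linearRep, Finset.sum_sub_distrib, Finset.sum_const, Finset.card_range,
    nsmul_eq_mul, smul_eq_mul, ← hAdef]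
  field_simp
  rw [Real.sq_sqrt hnR.le]
  ring

/-! ### Orthogonality of the residual -/

/-- If `g` is the conditional probability of `y = 1` given `x`, the residual is orthogonal to every
integrable function of `x`. -/
theorem integral_residual_mul_eq_zero {Ω : Type*} [MeasurableSpace Ω] {μ : Measure Ω}
    [IsProbabilityMeasure μ] {F : Type*} [MeasurableSpace F] {y : Ω → ℝ} {x : Ω → F}
    (hy : Measurable y) (hx : Measurable x) (hy01 : ∀ ω, y ω = 0 ∨ y ω = 1) {g₀ : F → ℝ}
    (hmodel : μ⟦{ω | y ω = 1} | MeasurableSpace.comap x inferInstance⟧ =ᵐ[μ] fun ω => g₀ (x ω))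
    {m : F → ℝ} (hm : Integrable m (μ.map x)) :
    ∫ ω, (y ω - g₀ (x ω)) * m (x ω) ∂μ = 0 := by
  have hle : MeasurableSpace.comap x inferInstance ≤ (inferInstance : MeasurableSpace Ω) :=
    hx.comap_le
  have hmx : Integrable (fun ω => m (x ω)) μ :=
    (integrable_map_measure hm.1 hx.aemeasurable).1 hm
  have hyb : ∀ ω, ‖y ω‖ ≤ 1 := fun ω => by rcases hy01 ω with h | h <;> simp [h]
  have hyint : Integrable y μ :=
    (integrable_const (1 : ℝ)).mono' hy.aestronglyMeasurable (Eventually.of_forall hyb)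
  -- For binary `y` the indicator of `y = 1` is `y` itself, so the model specifies the conditional
  -- expectation of `y`.
  have hind : (Set.indicator {ω | y ω = 1} fun _ => (1 : ℝ)) = y := by
    ext ω
    rcases hy01 ω with h | h <;> simp [h]
  rw [hind] at hmodel
  have hym : Integrable (y * fun ω => m (x ω)) μ := by
    refine hmx.norm.mono' (hy.aestronglyMeasurable.mul hmx.1) (Eventually.of_forall fun ω => ?_)
    simp only [Pi.mul_apply, norm_mul]
    exact mul_le_of_le_one_left (norm_nonneg _) (hyb ω)
  have hsm : AEStronglyMeasurable[MeasurableSpace.comap x inferInstance] (fun ω => m (x ω)) μ := by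
    refine ⟨fun ω => hm.1.mk m (x ω),
      hm.1.stronglyMeasurable_mk.comp_measurable (comap_measurable x), ?_⟩
    exact ae_of_ae_map hx.aemeasurable hm.1.ae_eq_mk
  have hpull := condExp_mul_of_aestronglyMeasurable_right hsm hym hyint
  have hpull' : μ[y * fun ω => m (x ω) | MeasurableSpace.comap x inferInstance] =ᵐ[μ]
      fun ω => g₀ (x ω) * m (x ω) := by
    filter_upwards [hpull, hmodel] with ω h1 h2
    rw [h1, Pi.mul_apply, h2]
  -- No bound on `g₀` is available; integrability is inherited from the conditional expectation of
  -- `y * m(x)`, which the pull-out rule identifies with this product.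
  have hgint : Integrable (fun ω => g₀ (x ω) * m (x ω)) μ := integrable_condExp.congr hpull'
  have heq : ∫ ω, (y * fun ω => m (x ω)) ω ∂μ = ∫ ω, g₀ (x ω) * m (x ω) ∂μ := by
    rw [← integral_condExp hle]
    exact integral_congr_ae hpull'
  simp only [sub_mul]
  rw [integral_sub (f := fun ω => y ω * m (x ω)) hym hgint]
  exact sub_eq_zero.2 heq

end PriorEstimation

/-! ### Reduction to the class `j` and conclusion -/

theorem mainTheorem1
    {Ω : Type*} [MeasurableSpace Ω] (μ : Measure Ω) [IsProbabilityMeasure μ]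
    {c f p : ℕ}
    -- the data: class identification vectors `Y i` and feature vectors `X i`, i.i.d. pairs
    (Y : ℕ → Ω → Fin c → ℝ) (X : ℕ → Ω → PriorEstimation.Vec f)
    (hYmeas : ∀ i, Measurable (Y i)) (hXmeas : ∀ i, Measurable (X i))
    (hY01 : ∀ i ω k, Y i ω k = 0 ∨ Y i ω k = 1)
    (hindep : iIndepFun (fun i ω => (Y i ω, X i ω)) μ)
    (hident : ∀ i, IdentDistrib (fun ω => (Y i ω, X i ω)) (fun ω => (Y 0 ω, X 0 ω)) μ μ)
    -- the semiparametric model for class `j`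
    (j : Fin c) (g : PriorEstimation.Vec f → PriorEstimation.Vec p → ℝ)
    (θ₀ : PriorEstimation.Vec p)
    (hgmeas : ∀ θ, Measurable fun t => g t θ)
    (hmodel : μ⟦{ω | Y 0 ω j = 1} | MeasurableSpace.comap (X 0) inferInstance⟧
      =ᵐ[μ] fun ω => g (X 0 ω) θ₀)
    -- numbers of labelled observations
    (r : ℕ → ℕ) (hr : ∀ n, r n ≤ n) (γ : ℝ) (hγ : 0 < γ)
    (hrγ : Tendsto (fun n => (r n : ℝ) / (n : ℝ)) atTop (𝓝 γ))
    -- regularity on the compact parameter set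
    (Θ : Set (PriorEstimation.Vec p)) (hΘ : IsCompact Θ) (hθ₀ : θ₀ ∈ interior Θ)
    (hg01 : ∀ᵐ t ∂(μ.map (X 0)), ∀ θ ∈ Θ, 0 < g t θ ∧ g t θ < 1)
    (hgC1 : ∀ᵐ t ∂(μ.map (X 0)), ∀ θ ∈ Θ, ContDiffAt ℝ 1 (fun η => g t η) θ)
    (h : PriorEstimation.Vec f → ℝ) (hint : Integrable h (μ.map (X 0)))
    (henv : ∀ᵐ t ∂(μ.map (X 0)), ∀ θ ∈ Θ,
      PriorEstimation.weight g t θ * ‖PriorEstimation.grad g t θ‖ ≤ h t)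
    (hunique : ∀ θ ∈ Θ, ∫ ω, PriorEstimation.score g (X 0 ω) (Y 0 ω j) θ ∂μ = 0 → θ = θ₀)
    -- regularity near the true parameter
    (N : Set (PriorEstimation.Vec p)) (hN : N ∈ 𝓝 θ₀)
    (hgC2 : ∀ᵐ t ∂(μ.map (X 0)), ∀ θ ∈ N, ContDiffAt ℝ 2 (fun η => g t η) θ)
    (henv2 : ∀ᵐ t ∂(μ.map (X 0)), ∀ θ ∈ N,
      (PriorEstimation.weight g t θ * ‖PriorEstimation.grad g t θ‖) ^ 2 ≤ h t ∧
      PriorEstimation.weight g t θ * ‖PriorEstimation.hess g t θ‖ ≤ h t)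
    (hA : IsUnit (PriorEstimation.matA g θ₀ (μ.map (X 0))).det)
    -- the estimator: with probability tending to one, a root in `Θ` of the estimating equation
    (θhat : ℕ → Ω → PriorEstimation.Vec p) (hθmeas : ∀ n, Measurable (θhat n))
    (hroot : Tendsto (fun n => μ {ω | ¬ (θhat n ω ∈ Θ ∧
      ∑ i ∈ Finset.range (r n), PriorEstimation.score g (X i ω) (Y i ω j) (θhat n ω) = 0)})
      atTop (𝓝 0)) :
    -- the difference of the two sides is `o_p(1)`
    TendstoInMeasure μ
      (fun (n : ℕ) ω =>
        √(n : ℝ) * (PriorEstimation.qHat g (fun i => X i ω) n (θhat n ω) - ∫ ω', Y 0 ω' j ∂μ) -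
        PriorEstimation.linearRep g θ₀ (μ.map (X 0)) (∫ ω', Y 0 ω' j ∂μ) γ
          (fun i => X i ω) (fun i => Y i ω j) (r n) n)
      atTop (fun _ => (0 : ℝ)) := by
  set y : ℕ → Ω → ℝ := fun i ω => Y i ω j with hy
  set W : ℕ → Ω → ℝ × PriorEstimation.Vec f := fun i ω => (y i ω, X i ω) with hWdef
  have hym : ∀ i, Measurable (y i) := fun i => (measurable_pi_apply j).comp (hYmeas i)
  have hW : ∀ i, Measurable (W i) := fun i => (hym i).prodMk (hXmeas i)
  have hproj : Measurable fun s : (Fin c → ℝ) × PriorEstimation.Vec f => (s.1 j, s.2) :=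
    ((measurable_pi_apply j).comp measurable_fst).prodMk measurable_snd
  have hind : iIndepFun W μ :=
    hindep.comp (fun _ (s : (Fin c → ℝ) × PriorEstimation.Vec f) => (s.1 j, s.2)) fun _ => hproj
  have hid : ∀ i, IdentDistrib (W i) (W 0) μ μ := fun i => (hident i).comp hproj
  have hsnd : (μ.map (W 0)).map Prod.snd = μ.map (X 0) := Measure.map_map measurable_snd (hW 0)
  have hbin : ∀ᵐ s ∂(μ.map (W 0)), s.1 = 0 ∨ s.1 = 1 := by
    refine (ae_map_iff (hW 0).aemeasurable ?_).2 (Eventually.of_forall fun ω => hY01 0 ω j)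
    exact (measurable_fst (measurableSet_singleton 0)).union
      (measurable_fst (measurableSet_singleton 1))
  -- One ball inside both `Θ` and `N`: the range and first envelope come from `Θ`, the second-order
  -- conditions from `N`.
  obtain ⟨R, hR, hball⟩ := Metric.nhds_basis_closedBall.mem_iff.1
    (Filter.inter_mem (mem_interior_iff_mem_nhds.1 hθ₀) hN)
  have hres : ∀ m : PriorEstimation.Vec f → ℝ, Integrable m (μ.map (X 0)) →
      ∫ s, (s.1 - g s.2 θ₀) * m s.2 ∂(μ.map (W 0)) = 0 := by
    intro m hm
    rw [← PriorEstimation.integral_residual_mul_eq_zero (hym 0) (hXmeas 0)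
      (g₀ := fun t => g t θ₀) (fun ω => hY01 0 ω j) hmodel hm]
    refine integral_map (hW 0).aemeasurable ?_
    rw [← hsnd] at hm
    exact (measurable_fst.sub ((hgmeas θ₀).comp measurable_snd)).aestronglyMeasurable.mul
      (hm.1.comp_measurable measurable_snd)
  have hM : PriorEstimation.LocalRegularity g θ₀ R (μ.map (W 0)) h :=
    { radius_pos := hR
      measurable := hgmeas
      binary := hbin
      range := by
        rw [hsnd]
        filter_upwards [hg01] with t ht θ hθ using ht θ (hball hθ).1
      smooth := by
        rw [hsnd]
        filter_upwards [hgC2] with t ht θ hθ using ht θ (hball hθ).2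
      integrable := by rwa [hsnd]
      env := by
        rw [hsnd]
        filter_upwards [henv] with t ht θ hθ using ht θ (hball hθ).1
      env_sq := by
        rw [hsnd]
        filter_upwards [henv2] with t ht θ hθ using (ht θ (hball hθ).2).1
      env_hess := by
        rw [hsnd]
        filter_upwards [henv2] with t ht θ hθ using (ht θ (hball hθ).2).2
      residual_orthogonal := by rwa [hsnd] }
  have hr' : Tendsto r atTop atTop := by
    have h1 : Tendsto (fun n : ℕ => (r n : ℝ) / (n : ℝ) * (n : ℝ)) atTop atTop :=
      hrγ.pos_mul_atTop hγ tendsto_natCast_atTop_atTop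
    refine tendsto_natCast_atTop_iff.1 (h1.congr' ?_)
    filter_upwards [eventually_gt_atTop 0] with n hn
    have : (n : ℝ) ≠ 0 := by exact_mod_cast hn.ne'
    field_simp
  have hroot' : EventuallyInProb μ fun n ω => θhat n ω ∈ Θ ∧ ∑ i ∈ Finset.range (r n),
      PriorEstimation.score g (W i ω).2 (W i ω).1 (θhat n ω) = 0 := hroot
  have hcons : ∀ δ > 0, EventuallyInProb μ fun n ω => θhat n ω ∈ Metric.ball θ₀ δ := by
    intro δ hδ
    refine PriorEstimation.eventuallyInProb_root_mem_ball (h := h) hW hind hid hΘ hbin hgmeas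
      (by rwa [hsnd]) (by rwa [hsnd]) (by rwa [hsnd]) (by rwa [hsnd]) ?_ hr' hroot' hδ
    intro θ hθ hzero
    refine hunique θ hθ (Eq.trans ?_ hzero)
    refine (integral_map (hW 0).aemeasurable
      (PriorEstimation.aestronglyMeasurable_score hgmeas ?_)).symm
    rw [hsnd]
    filter_upwards [hgC1] with t ht using (ht θ hθ).differentiableAt one_ne_zero
  have hmain := PriorEstimation.tendstoInMeasure_qHat_sub_linearRep hW hind hid hM
    (by rwa [hsnd]) hr hγ hrγ hr'
    (hroot'.mono (Eventually.of_forall fun n => Eventually.of_forall fun ω hω => hω.2)) hcons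
    (∫ ω', Y 0 ω' j ∂μ)
  rwa [hsnd] at hmain
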